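/- Fix an integer $k\ge 0$. Let $\mathcal L$ be the family of all lines of slope $0$, $-1$ and $\infty$ in $\mathbb R^2$ through integral points, each line cut at the integral points into segments. For $(p,q)\in\mathbb Z^2$ let $\gamma^L_{(p,q)}$ be the straight segment directed from $(0,0)$ to $(p,q)$, pushed slightly to its left near each interior point of it of the form $(n/2,m/2)$ with $n,m\in\mathbb Z$. Let $\tau_1,\dots,\tau_r$ be the segments of $\mathcal L$ crossed by $\gamma^L_{(p,q)}$, in order, and let $\mathcal P_{(p,q)}$ be the poset on the elements $(\tau_j,i)$ with $1\le j\le r$, $0\le i\le k$, whose order is generated by the following relations. - If the crossing point with $\tau_j$ is strictly closer to the endpoint of $\tau_j$ on the right of the curve than to the one on its left, then $(\tau_j,0)\succ(\tau_j,1)\succ\cdots\succ(\tau_j,k)$; otherwise $(\tau_j,0)\prec(\tau_j,1)\prec\cdots\prec(\tau_j,k)$. - If the common endpoint of $\tau_j$ and $\tau_{j+1}$ lies to the right of the curve, then $(\tau_j,k)\succ(\tau_{j+1},0)$; if it lies to the left, then $(\tau_j,k)\prec(\tau_{j+1},0)$. Let $m^{(k)}_{(p,q)}$ be the number of order ideals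 (downward closed subsets, including the empty one) of $\mathcal P_{(p,q)}$. Put $$\alpha=4k^2+12k+5,\qquad \beta=3k^2+8k+6,\qquad \delta=3k^4+17k^3+34k^2+28k+8,$$ $$A=\frac{2k^2+3k+1+(1+k)\sqrt\alpha}{2(1+2k)\sqrt\alpha},\qquad B=\frac{(k+1)(k+2)(\beta^2-4)+\delta\sqrt{\beta^2-4}}{(\beta-2)(\beta^2-4)}.$$ **Lemma.** For any two coprime positive integers $a_1,a_2$, the limits $$S(a_1,a_2)_-:=\lim_{q\to\infty}\frac{m^{(k)}_{(q(1+a_1)+a_2,\;1)}}{m^{(k)}_{(q(1+a_1),\;1+a_1)}},\qquad S(a_1,a_2)_+:=\lim_{q\to\infty}\frac{m^{(k)}_{((q+1)(1+a_1+a_2),\;q(1+a_1+a_2))}}{m^{(k)}_{(q(1+a_1+a_2)+a_1+1,\;q(1+a_1+a_2)+a_1)}}$$ (over positive integers $q$) exist, and $$S(a_1,a_2)_-=\bigl((3+3k)A\bigr)^{-a_1}\left(\frac{3+2k+\sqrt\alpha}{2}\right)^{a_2},\qquad S(a_1,a_2)_+=\bigl((3+3k)B\bigr)^{a_1+a_2}\left(\frac{\beta+\sqrt{\beta^2-4}}{2}\right)^{-a_1}.$$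 -/

import Mathlib

open Filter Topology

/-- The planar determinant of two integer vectors. For a direction `v` and a lattice point `P`,
`0 < planeDet v P` says that `P` lies strictly to the left of the line through the origin directed by
`v`, and `|planeDet v P|` is proportional to the distance of `P` from this line. -/
def planeDet (v w : ℤ × ℤ) : ℤ := v.1 * w.2 - v.2 * w.1

/-- The planar dot product of two integer vectors. -/
def planeDot (v w : ℤ × ℤ) : ℤ := v.1 * w.1 + v.2 * w.2

/-- `P` and `Q` are the two endpoints of one of the segments (between consecutive
integral points) of the lattice `𝓛` of all lines
of slope `0`, `∞` and `-1` through integral points. -/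
def IsLatticeSegment (P Q : ℤ × ℤ) : Prop :=
  Q - P = (1, 0) ∨ Q - P = (-1, 0) ∨ Q - P = (0, 1) ∨ Q - P = (0, -1) ∨
    Q - P = (1, -1) ∨ Q - P = (-1, 1)

/-- The parameter `t` at which the line `t ↦ t • v` meets the line through `L` and `R`
(Cramer's rule for `t • v = L + s • (R - L)`). -/
def hitTime (v L R : ℤ × ℤ) : ℚ := (planeDet R L : ℚ) / (planeDet v (L - R) : ℚ)

/-- The velocity, in `ε`, of the parameter at which the line is met by the segment when the line
`t ↦ t • v` is pushed to its left to `t ↦ t • v + ε • (-v.2, v.1)`: the parameter becomes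
`hitTime v L R + ε * hitDrift v L R`. -/
def hitDrift (v L R : ℤ × ℤ) : ℚ := (planeDot v (L - R) : ℚ) / (planeDet v (L - R) : ℚ)

/-- A crossing of the curve `γ^L_v` with a segment of `𝓛`. Here `γ^L_v` is the straight segment
from the origin to `v` (directed from the origin to `v`), pushed slightly to its left at
every interior point of it that has half-integral coordinates.
A lattice point in the interior of the straight segment is passed on its left, so it counts as
lying to the right of the curve, and so a segment of `𝓛` is crossed exactly if one endpoint
`left` is strictly to the left of the line, the other endpoint `right` is on the line or to the
right of it, and the straight segment meets it at a point other than its two ends `0` and `v`.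
(The segments with `planeDet v right = 0` are those crossed on the detour around `right`.) -/
@[ext] structure Crossing (v : ℤ × ℤ) where
  /-- the endpoint of the crossed segment to the left of the curve -/
  left : ℤ × ℤ
  /-- the endpoint of the crossed segment to the right of the curve -/
  right : ℤ × ℤ
  isSegment : IsLatticeSegment left right
  left_pos : 0 < planeDet v left
  right_nonpos : planeDet v right ≤ 0
  time_pos : 0 < hitTime v left right
  time_lt_one : hitTime v left right < 1

namespace Crossing

variable {v : ℤ × ℤ}

/-- The position of a crossing along `γ^L_v`: crossings come in the order of the parameter of the
line, and the crossings met on the detour around one lattice point, which share this parameter,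
come in the order in which a slight left translate of the line meets them. -/
def position (c : Crossing v) : ℚ ×ₗ ℚ :=
  toLex (hitTime v c.left c.right, hitDrift v c.left c.right)

/-- The curve crosses the segments of `c` and `c'` consecutively, in this order. -/
def Consecutive (c c' : Crossing v) : Prop :=
  c.position < c'.position ∧ ∀ d : Crossing v, ¬ (c.position < d.position ∧
    d.position < c'.position)

/-- The crossing point is strictly closer to the right endpoint of the segment than to the left
one. A straight line through the midpoint is pushed to the left there, so
that this case does not count. -/
def CloserToRight (c : Crossing v) : Prop := |planeDet v c.right| < |planeDet v c.left|

end Crossing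

/-- The generating relations `x ≺ y` of the fence poset `𝒫_v`. Its elements are the pairs `(τ, i)`
with `τ` a crossing of `γ^L_v` and `0 ≤ i ≤ k`. -/
inductive FenceRel (k : ℕ) (v : ℤ × ℤ) :
    Crossing v × Fin (k + 1) → Crossing v × Fin (k + 1) → Prop
  /-- If the crossing is closer to the right endpoint, then `(τ,0) ≻ (τ,1) ≻ ⋯ ≻ (τ,k)`. -/
  | chainDown (c : Crossing v) (i : Fin k) (h : c.CloserToRight) :
      FenceRel k v (c, i.succ) (c, i.castSucc)
  /-- Otherwise `(τ,0) ≺ (τ,1) ≺ ⋯ ≺ (τ,k)`. -/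
  | chainUp (c : Crossing v) (i : Fin k) (h : ¬ c.CloserToRight) :
      FenceRel k v (c, i.castSucc) (c, i.succ)
  /-- If the common endpoint of consecutive `τ`, `τ'` is on the right, then `(τ,k) ≻ (τ',0)`. -/
  | linkDown (c c' : Crossing v) (h : c.Consecutive c') (hr : c.right = c'.right) :
      FenceRel k v (c', 0) (c, Fin.last k)
  /-- If the common endpoint of consecutive `τ`, `τ'` is on the left, then `(τ,k) ≺ (τ',0)`. -/
  | linkUp (c c' : Crossing v) (h : c.Consecutive c') (hl : c.left = c'.left) :
      FenceRel k v (c, Fin.last k) (c', 0)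

/-- The order of the fence poset `𝒫_v`: the reflexive transitive closure of its generating
relations. -/
def FenceLE (k : ℕ) (v : ℤ × ℤ) (x y : Crossing v × Fin (k + 1)) : Prop :=
  Relation.ReflTransGen (FenceRel k v) x y

/-- The order ideals (downwards closed subsets, the empty one included) of `𝒫_v`. -/
def fenceIdeals (k : ℕ) (v : ℤ × ℤ) : Set (Set (Crossing v × Fin (k + 1))) :=
  {I | ∀ x ∈ I, ∀ y, FenceLE k v y x → y ∈ I}

/-- The generalized `k`-Markov number `m^{(k)}_{(p,q)}`: the number of order ideals of the fence
poset `𝒫_{(p,q)}`. -/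
noncomputable def genMarkov (k : ℕ) (p q : ℤ) : ℕ := (fenceIdeals k (p, q)).ncard

/-!
Membership along a fence is a sequence of two-state steps, so the order ideals are counted by the
entries of a product of the matrices `!![1, 1; 0, 1]` and `!![1, 0; 1, 1]`, one for each covering
relation. At a lattice point in its interior the curve makes a detour with the same three crossings
each time, so the fence of `(d + 1) • v` has the matrix `(M * D) ^ d * M`, where `M` is the matrix
of `v` and `D` that of the detour. Both have determinant one, and if the lower off-diagonal entry
of `M` exceeds the upper one by `k`, then `M * D` has the trace `(3 + 3 * k) * m - k`, where `m`
counts the ideals for `v`; by Cayley–Hamilton the count for `(d + 1) • v` is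
`m * S_d ((3 + 3 * k) * m - k)`, with a Chebyshev polynomial `S_d`, which is asymptotic to
`(3 + 3 * k) ^ d * m ^ (d + 1)` as `m` grows.

The fences of `(n + 2, 1)` and `(n + 3, n + 2)` prolong those of `(n, 1)` and `(n + 1, n)` at both
ends, which conjugates the matrix as in `P * M * Pᵀ`. Hence the matrices of these two families obey
linear recursions of order two, which keep the difference of the off-diagonal entries constant and
make the counts asymptotic to `A * λ ^ n` and `B * μ ^ n`, with `λ` and `μ` the larger
characteristic roots.
-/

section OrderedProducts

variable {M : Type*} [Monoid M] (f : ℕ → M)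

lemma prod_range_add (m n : ℕ) :
    ((List.range (m + n)).map f).prod =
      ((List.range m).map f).prod * ((List.range n).map fun i => f (m + i)).prod := by
  rw [List.range_add, List.map_append, List.prod_append, List.map_map, Function.comp_def]

lemma prod_range_mul (m n : ℕ) :
    ((List.range (m * n)).map f).prod =
      ((List.range n).map fun i => ((List.range m).map fun j => f (m * i + j)).prod).prod := by
  induction n with
  | zero => simp
  | succ n ih => rw [Nat.mul_succ, prod_range_add, ih, List.prod_range_succ]

variable {f}

lemma prod_range_congr {g : ℕ → M} {n : ℕ} (h : ∀ i < n, f i = g i) :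
    ((List.range n).map f).prod = ((List.range n).map g).prod := by
  rw [List.map_congr_left fun i hi => h i (List.mem_range.1 hi)]

lemma prod_range_const (a : M) (n : ℕ) : ((List.range n).map fun _ => a).prod = a ^ n := by
  rw [List.map_const', List.length_range, List.prod_replicate]

lemma prod_range_mul_of_periodic {m : ℕ} (hf : Function.Periodic f m) (n : ℕ) :
    ((List.range (m * n)).map f).prod = ((List.range m).map f).prod ^ n := by
  rw [prod_range_mul, ← prod_range_const]
  refine prod_range_congr fun i _ => prod_range_congr fun j _ => ?_
  rw [add_comm, mul_comm, ← smul_eq_mul, hf.nsmul i j]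

end OrderedProducts

section PathSums

variable {R ι : Type*} [CommSemiring R] [Fintype ι] [DecidableEq ι] (f : ℕ → Matrix ι ι R)

lemma sum_path_cons_eq (n : ℕ) (a : ι) :
    ∑ χ : Fin n → ι, ∏ t : Fin n,
        f t (Fin.cons (α := fun _ => ι) a χ t.castSucc) (χ t) =
      ∑ b, ((List.range n).map f).prod a b := by
  induction n generalizing a f with
  | zero => simp [Matrix.one_apply]
  | succ n ih =>
    rw [← (Fin.consEquiv fun _ => ι).sum_comp, Fintype.sum_prod_type]
    simp only [Fin.consEquiv_apply, Fin.prod_univ_succ, Fin.castSucc_zero, Fin.cons_zero,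
      ← Fin.succ_castSucc, Fin.cons_succ, Fin.val_zero, Fin.val_succ, ← Finset.mul_sum,
      ih fun i => f (i + 1)]
    simp only [List.prod_range_succ', Matrix.mul_apply, Finset.mul_sum]
    exact Finset.sum_comm

lemma sum_path_eq (n : ℕ) :
    ∑ χ : Fin (n + 1) → ι, ∏ t : Fin n, f t (χ t.castSucc) (χ t.succ) =
      ∑ a, ∑ b, ((List.range n).map f).prod a b := by
  rw [← (Fin.consEquiv fun _ => ι).sum_comp, Fintype.sum_prod_type]
  simp only [Fin.consEquiv_apply, Fin.cons_succ, sum_path_cons_eq]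

end PathSums

section Fences

/-- The sum of the entries of a `2 × 2` matrix, which counts the paths between two states that are
weighted by a transfer matrix. -/
def entrySum (R : Type*) [CommSemiring R] : Matrix (Fin 2) (Fin 2) R →ₗ[R] R :=
  ∑ a, ∑ b, Matrix.entryLinearMap R R a b

lemma entrySum_apply {R : Type*} [CommSemiring R] (M : Matrix (Fin 2) (Fin 2) R) :
    entrySum R M = ∑ a, ∑ b, M a b := by
  simp only [entrySum, LinearMap.sum_apply, Matrix.entryLinearMap_apply]

lemma entrySum_of {R : Type*} [CommSemiring R] (a b c d : R) :
    entrySum R !![a, b; c, d] = a + b + (c + d) := by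
  simp [entrySum_apply]

/-- `R` generates a fence poset on `X`, whose elements are enumerated by `e` along the fence: the
`t`-th and the `(t + 1)`-st element are related, and the latter is the smaller one if and only if
`down t` holds. -/
def IsFenceAlong {X : Type*} {n : ℕ} (R : X → X → Prop) (e : X ≃ Fin n) (down : ℕ → Bool) : Prop :=
  ∀ x y, R x y ↔ ((e x : ℕ) = e y + 1 ∧ down (e y) = true) ∨
    ((e y : ℕ) = e x + 1 ∧ down (e x) = false)

/-- The transfer matrix of one covering relation of a fence: its entry `(a, b)` tells whether two
consecutive elements can have membership `a` and `b` in an order ideal. The Boolean tells whether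
the fence goes down. -/
def stepMatrix (R : Type*) [Semiring R] (down : Bool) : Matrix (Fin 2) (Fin 2) R :=
  if down then !![1, 1; 0, 1] else !![1, 0; 1, 1]

lemma stepMatrix_apply (R : Type*) [Semiring R] (d : Bool) (a b : Fin 2) :
    stepMatrix R d a b =
      if (if d then a = 1 → b = 1 else b = 1 → a = 1) then 1 else 0 := by
  cases d <;> fin_cases a <;> fin_cases b <;> simp [stepMatrix]

lemma forall_mem_of_reflTransGen_iff {X : Type*} {R : X → X → Prop} {I : Set X} :
    (∀ x ∈ I, ∀ y, Relation.ReflTransGen R y x → y ∈ I) ↔ ∀ x ∈ I, ∀ y, R y x → y ∈ I := by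
  refine ⟨fun h x hx y hyx => h x hx y (.single hyx), fun h x hx y hyx => ?_⟩
  induction hyx using Relation.ReflTransGen.head_induction_on with
  | refl => exact hx
  | head hab _ ih => exact h _ ih _ hab

lemma IsFenceAlong.forall_mem_iff {X : Type*} {R : X → X → Prop} {n : ℕ} {e : X ≃ Fin (n + 1)}
    {down : ℕ → Bool} (h : IsFenceAlong R e down) {I : Set X} :
    (∀ x ∈ I, ∀ y, R y x → y ∈ I) ↔ ∀ t : Fin n,
      if down t then e.symm t.castSucc ∈ I → e.symm t.succ ∈ I
        else e.symm t.succ ∈ I → e.symm t.castSucc ∈ I := by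
  refine ⟨fun hI t => ?_, fun hI x hx y hyx => ?_⟩
  · split_ifs with hd
    · exact fun hx => hI _ hx _ ((h _ _).2 (.inl (by simpa using hd)))
    · exact fun hx => hI _ hx _ ((h _ _).2 (.inr (by simpa using hd)))
  · have key : ∀ t : Fin n, ∀ {z w : X}, e z = t.castSucc → e w = t.succ →
        if down t then z ∈ I → w ∈ I else w ∈ I → z ∈ I := by
      intro t z w hz hw
      simpa only [← hz, ← hw, e.symm_apply_apply] using hI t
    rcases (h y x).1 hyx with ⟨hs, hd⟩ | ⟨hs, hd⟩
    · have := key ⟨e x, by lia⟩ (z := x) (w := y) rfl (Fin.ext hs)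
      rw [if_pos hd] at this
      exact this hx
    · have := key ⟨e y, by lia⟩ (z := y) (w := x) rfl (Fin.ext hs)
      rw [if_neg (by simp [hd])] at this
      exact this hx

theorem IsFenceAlong.ncard_ideals {X : Type*} {R : X → X → Prop} {n : ℕ} {e : X ≃ Fin (n + 1)}
    {down : ℕ → Bool} (h : IsFenceAlong R e down) (S : Type*) [CommSemiring S] :
    (({I | ∀ x ∈ I, ∀ y, Relation.ReflTransGen R y x → y ∈ I} : Set (Set X)).ncard : S) =
      entrySum S ((List.range n).map fun t => stepMatrix S (down t)).prod := by
  classical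
  let membership : Set X ≃ (Fin (n + 1) → Fin 2) :=
    e.arrowCongr (Equiv.propEquivBool.trans finTwoEquiv.symm)
  have mem_iff (I : Set X) (t : Fin (n + 1)) : e.symm t ∈ I ↔ membership I t = 1 := by
    change e.symm t ∈ I ↔ finTwoEquiv.symm (decide (e.symm t ∈ I)) = 1
    by_cases ht : e.symm t ∈ I <;> simp [ht, finTwoEquiv]
  let Allowed : (Fin (n + 1) → Fin 2) → Prop := fun χ => ∀ t : Fin n,
    if down t then χ t.castSucc = 1 → χ t.succ = 1 else χ t.succ = 1 → χ t.castSucc = 1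
  have ideals_equiv : {I : Set X // ∀ x ∈ I, ∀ y, Relation.ReflTransGen R y x → y ∈ I} ≃
      {χ // Allowed χ} := membership.subtypeEquiv fun I => by
    simp only [forall_mem_of_reflTransGen_iff, h.forall_mem_iff, mem_iff, Allowed]
  have weight_eq (χ : Fin (n + 1) → Fin 2) :
      ∏ t : Fin n, stepMatrix S (down t) (χ t.castSucc) (χ t.succ) =
        if Allowed χ then 1 else 0 := by
    simp only [stepMatrix_apply, Finset.prod_boole, Finset.mem_univ, true_implies, Allowed]
  rw [← Nat.card_coe_set_eq, Set.coe_ofPred, Nat.card_congr ideals_equiv, Nat.card_eq_fintype_card,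
    Fintype.card_subtype, ← Finset.sum_boole, entrySum_apply, ← sum_path_eq]
  simp only [weight_eq]

end Fences

section LatticePoints

variable {p q : ℕ}

/-- The remainder that measures how far the antidiagonal point `rightPoint p q s` is from the line
through the origin and `(p, q)`, see `planeDet_rightPoint`. -/
def offset (p q s : ℕ) : ℕ := q * s % (p + q)

/-- The first lattice point on the antidiagonal `x + y = s` that is not to the left of the line
through the origin and `(p, q)`. -/
def rightPoint (p q s : ℕ) : ℤ × ℤ := (s - (q * s / (p + q) : ℕ), (q * s / (p + q) : ℕ))

/-- The last lattice point on the antidiagonal `x + y = s` that is to the left of the line through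
the origin and `(p, q)`. -/
def leftPoint (p q s : ℕ) : ℤ × ℤ := rightPoint p q s + (-1, 1)

lemma planeDet_add (v w w' : ℤ × ℤ) : planeDet v (w + w') = planeDet v w + planeDet v w' := by
  simp only [planeDet, Prod.fst_add, Prod.snd_add]
  ring

lemma planeDet_self (v : ℤ × ℤ) : planeDet v v = 0 := by
  rw [planeDet, mul_comm, sub_self]

lemma offset_lt (hp : 0 < p) (s : ℕ) : offset p q s < p + q := Nat.mod_lt _ (by lia)

@[simp] lemma rightPoint_fst_add_snd (s : ℕ) : (rightPoint p q s).1 + (rightPoint p q s).2 = s :=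
  sub_add_cancel _ _

@[simp] lemma leftPoint_fst_add_snd (s : ℕ) : (leftPoint p q s).1 + (leftPoint p q s).2 = s := by
  rw [leftPoint, Prod.fst_add, Prod.snd_add, add_add_add_comm, rightPoint_fst_add_snd]
  simp

lemma rightPoint_injective : Function.Injective (rightPoint p q) := fun s t h => by
  simpa using congrArg (fun P => P.1 + P.2) h

lemma leftPoint_injective : Function.Injective (leftPoint p q) := fun s t h => by
  simpa using congrArg (fun P => P.1 + P.2) h

lemma planeDet_rightPoint (s : ℕ) : planeDet (p, q) (rightPoint p q s) = -offset p q s := by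
  have div_add_mod : ((p : ℤ) + q) * (q * s / (p + q) : ℕ) + offset p q s = q * s := by
    exact_mod_cast Nat.div_add_mod (q * s) (p + q)
  simp only [planeDet, rightPoint]
  linear_combination div_add_mod

lemma planeDet_leftPoint (s : ℕ) :
    planeDet (p, q) (leftPoint p q s) = p + q - offset p q s := by
  rw [leftPoint, planeDet_add, planeDet_rightPoint, planeDet]
  ring

lemma eq_rightPoint {P : ℤ × ℤ} {s : ℕ} (hs : P.1 + P.2 = s) (hle : planeDet (p, q) P ≤ 0)
    (hlt : -(p + q : ℤ) < planeDet (p, q) P) : P = rightPoint p q s := by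
  rw [planeDet] at hle hlt
  have hdiv : (q * s : ℤ) / (p + q) = P.2 :=
    ((Int.ediv_emod_unique (r := q * P.1 - p * P.2) (by lia)).2
      ⟨by rw [← hs]; ring, by lia, by lia⟩).1
  ext
  · simp only [rightPoint]
    push_cast
    lia
  · simp only [rightPoint]
    exact_mod_cast hdiv.symm

lemma rightPoint_succ_of_lt {s : ℕ} (h : offset p q s < p) :
    rightPoint p q (s + 1) = rightPoint p q s + (1, 0) := by
  have det_eq : planeDet (p, q) (rightPoint p q s + (1, 0)) = -offset p q s - q := by
    rw [planeDet_add, planeDet_rightPoint, planeDet]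
    ring
  refine (eq_rightPoint ?_ (by lia) (by lia)).symm
  rw [Prod.fst_add, Prod.snd_add, add_add_add_comm, rightPoint_fst_add_snd]
  simp

lemma rightPoint_succ_of_le (hp : 0 < p) {s : ℕ} (h : p ≤ offset p q s) :
    rightPoint p q (s + 1) = rightPoint p q s + (0, 1) := by
  have det_eq : planeDet (p, q) (rightPoint p q s + (0, 1)) = p - offset p q s := by
    rw [planeDet_add, planeDet_rightPoint, planeDet]
    ring
  have := offset_lt (q := q) hp s
  refine (eq_rightPoint ?_ (by lia) (by lia)).symm
  rw [Prod.fst_add, Prod.snd_add, add_add_add_comm, rightPoint_fst_add_snd]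
  simp

lemma offset_succ_of_lt {s : ℕ} (h : offset p q s < p) :
    offset p q (s + 1) = offset p q s + q := by
  rw [offset, mul_add_one, ← Nat.mod_add_mod, Nat.mod_eq_of_lt (by rw [← offset]; lia), offset]

lemma offset_succ_of_le (hp : 0 < p) {s : ℕ} (h : p ≤ offset p q s) :
    offset p q (s + 1) = offset p q s - p := by
  have := offset_lt (q := q) hp s
  rw [offset, mul_add_one, ← Nat.mod_add_mod, ← offset,
    show offset p q s + q = offset p q s - p + (p + q) by lia, Nat.add_mod_right,
    Nat.mod_eq_of_lt (by lia)]

end LatticePoints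

section Crossings

variable {p q : ℕ}

lemma Crossing.left_eq {v : ℤ × ℤ} (h₁ : 0 < v.1) (h₂ : 0 < v.2) (c : Crossing v) :
    c.left = c.right + (0, 1) ∨ c.left = c.right + (-1, 0) ∨ c.left = c.right + (-1, 1) := by
  have det_pos : 0 < planeDet v (c.left - c.right) := by
    have := planeDet_add v (c.left - c.right) c.right
    rw [sub_add_cancel] at this
    linarith [c.left_pos, c.right_nonpos]
  simp only [← sub_eq_iff_eq_add']
  rw [← neg_sub c.right] at det_pos ⊢
  rcases c.isSegment with h | h | h | h | h | h <;> rw [h] at det_pos ⊢ <;>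
    simp only [planeDet, Prod.neg_mk, Prod.mk.injEq] at det_pos ⊢ <;> lia

lemma mem_Ioo_iff_of_mul_eq {a b x s ρ : ℤ} (ha : 0 < a) (hb : 0 < b) (hρ : 0 ≤ ρ) (hlt : ρ < a)
    (h : (a + b) * x = a * s + ρ) : 0 < x ∧ x < a ↔ 0 < s ∧ s + 1 < a + b := by
  constructor
  · rintro ⟨hx, hxa⟩
    exact ⟨by nlinarith, by nlinarith⟩
  · rintro ⟨hs, hsa⟩
    exact ⟨by nlinarith, by nlinarith⟩

lemma hitTime_add_left (v P w : ℤ × ℤ) :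
    hitTime v (P + w) P = planeDet P w / planeDet v w := by
  rw [hitTime, planeDet_add, planeDet_self, zero_add, add_sub_cancel_left]

lemma hitDrift_add_left (v P w : ℤ × ℤ) :
    hitDrift v (P + w) P = planeDot v w / planeDet v w := by
  rw [hitDrift, add_sub_cancel_left]

lemma exists_crossing_add_left_iff {v P w : ℤ × ℤ} (hw : IsLatticeSegment w 0)
    (hvw : 0 < planeDet v w) :
    (∃ c : Crossing v, c.left = P + w ∧ c.right = P) ↔
      (-planeDet v w < planeDet v P ∧ planeDet v P ≤ 0) ∧
        0 < planeDet P w ∧ planeDet P w < planeDet v w := by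
  have hvwQ : (0 : ℚ) < planeDet v w := by exact_mod_cast hvw
  constructor
  · rintro ⟨c, hl, rfl⟩
    have hpos := c.left_pos
    have h0 := c.time_pos
    have h1 := c.time_lt_one
    rw [hl, planeDet_add] at hpos
    rw [hl, hitTime_add_left] at h0 h1
    exact ⟨⟨by lia, c.right_nonpos⟩, by exact_mod_cast (div_pos_iff_of_pos_right hvwQ).1 h0,
      by exact_mod_cast (div_lt_one hvwQ).1 h1⟩
  · rintro ⟨⟨hl, hr⟩, h0, h1⟩
    refine ⟨⟨P + w, P, ?_, by rw [planeDet_add]; lia, hr, ?_, ?_⟩, rfl, rfl⟩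
    · rwa [IsLatticeSegment, sub_add_cancel_left, ← zero_sub]
    · rw [hitTime_add_left]
      exact div_pos (by exact_mod_cast h0) hvwQ
    · rw [hitTime_add_left, div_lt_one hvwQ]
      exact_mod_cast h1

lemma exists_vertical_crossing_iff (hp : 0 < p) (hq : 0 < q) {P : ℤ × ℤ} :
    (∃ c : Crossing (p, q), c.left = P + (0, 1) ∧ c.right = P) ↔
      (-p < planeDet (p, q) P ∧ planeDet (p, q) P ≤ 0) ∧
        0 < P.1 + P.2 ∧ P.1 + P.2 + 1 < p + q := by
  rw [exists_crossing_add_left_iff (by simp [IsLatticeSegment]) (by simpa [planeDet])]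
  simp only [planeDet, mul_one, mul_zero, sub_zero]
  refine and_congr_right fun ⟨_, _⟩ =>
    mem_Ioo_iff_of_mul_eq (ρ := q * P.1 - p * P.2) ?_ ?_ ?_ ?_ ?_ <;> lia

lemma exists_horizontal_crossing_iff (hp : 0 < p) (hq : 0 < q) {P : ℤ × ℤ} :
    (∃ c : Crossing (p, q), c.left = P + (-1, 0) ∧ c.right = P) ↔
      (-q < planeDet (p, q) P ∧ planeDet (p, q) P ≤ 0) ∧
        1 < P.1 + P.2 ∧ P.1 + P.2 < p + q := by
  rw [exists_crossing_add_left_iff (by simp [IsLatticeSegment]) (by simpa [planeDet])]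
  simp only [planeDet, mul_neg, mul_one, mul_zero, zero_sub, neg_neg]
  refine and_congr_right fun ⟨_, _⟩ => ?_
  have reflected := mem_Ioo_iff_of_mul_eq (a := q) (b := p) (x := q - P.2)
    (s := p + q - (P.1 + P.2)) (ρ := q * P.1 - p * P.2) (by lia) (by lia) (by lia) (by lia)
    (by ring)
  lia

lemma exists_diagonal_crossing_iff (hp : 0 < p) {P : ℤ × ℤ} :
    (∃ c : Crossing (p, q), c.left = P + (-1, 1) ∧ c.right = P) ↔
      (-(p + q) < planeDet (p, q) P ∧ planeDet (p, q) P ≤ 0) ∧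
        0 < P.1 + P.2 ∧ P.1 + P.2 < p + q := by
  rw [exists_crossing_add_left_iff (by simp [IsLatticeSegment]) (by simp [planeDet]; lia)]
  simp only [planeDet, mul_neg, mul_one, sub_neg_eq_add]
lemma exists_diagonal_crossing (hp : 0 < p) {s : ℕ} (hs : 0 < s) (hlt : s < p + q) :
    ∃ c : Crossing (p, q), c.left = leftPoint p q s ∧ c.right = rightPoint p q s := by
  have := offset_lt (q := q) hp s
  refine (exists_diagonal_crossing_iff hp).2 ?_
  rw [planeDet_rightPoint, rightPoint_fst_add_snd]
  lia

lemma exists_vertical_crossing (hp : 0 < p) (hq : 0 < q) {s : ℕ} (hs : 0 < s)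
    (hlt : s + 1 < p + q) (hoff : offset p q s < p) :
    ∃ c : Crossing (p, q), c.left = leftPoint p q (s + 1) ∧ c.right = rightPoint p q s := by
  rw [leftPoint, rightPoint_succ_of_lt hoff, add_assoc]
  refine (exists_vertical_crossing_iff hp hq).2 ?_
  rw [planeDet_rightPoint, rightPoint_fst_add_snd]
  lia

lemma exists_horizontal_crossing (hp : 0 < p) (hq : 0 < q) {s : ℕ} (hs : 0 < s)
    (hlt : s + 1 < p + q) (hoff : p ≤ offset p q s) :
    ∃ c : Crossing (p, q), c.left = leftPoint p q s ∧ c.right = rightPoint p q (s + 1) := by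
  have := offset_lt (q := q) hp s
  have left_eq : leftPoint p q s = rightPoint p q (s + 1) + (-1, 0) := by
    rw [leftPoint, rightPoint_succ_of_le hp hoff, add_assoc]
    rfl
  rw [left_eq]
  refine (exists_horizontal_crossing_iff hp hq).2 ?_
  rw [planeDet_rightPoint, rightPoint_fst_add_snd, offset_succ_of_le hp hoff]
  lia

lemma Crossing.eq_of_left_eq_add_neg_one_one (hp : 0 < p) {c : Crossing (p, q)}
    (h : c.left = c.right + (-1, 1)) :
    ∃ s, 0 < s ∧ s < p + q ∧ c.left = leftPoint p q s ∧ c.right = rightPoint p q s := by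
  obtain ⟨⟨hlt, hle⟩, hs⟩ := (exists_diagonal_crossing_iff hp).1 ⟨c, h, rfl⟩
  lift c.right.1 + c.right.2 to ℕ using by lia with s sum_eq
  have right_eq := eq_rightPoint sum_eq.symm hle hlt
  exact ⟨s, by lia, by lia, by rw [h, right_eq, leftPoint], right_eq⟩

lemma Crossing.eq_of_left_eq_add_zero_one (hp : 0 < p) (hq : 0 < q) {c : Crossing (p, q)}
    (h : c.left = c.right + (0, 1)) :
    ∃ s, 0 < s ∧ s + 1 < p + q ∧ offset p q s < p ∧
      c.left = leftPoint p q (s + 1) ∧ c.right = rightPoint p q s := by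
  obtain ⟨⟨hlt, hle⟩, hs⟩ := (exists_vertical_crossing_iff hp hq).1 ⟨c, h, rfl⟩
  lift c.right.1 + c.right.2 to ℕ using by lia with s sum_eq
  have right_eq := eq_rightPoint sum_eq.symm hle (by lia)
  have hoff : offset p q s < p := by
    rw [right_eq, planeDet_rightPoint] at hlt
    lia
  refine ⟨s, by lia, by lia, hoff, ?_, right_eq⟩
  rw [h, right_eq, leftPoint, rightPoint_succ_of_lt hoff, add_assoc]
  rfl

lemma Crossing.eq_of_left_eq_add_neg_one_zero (hp : 0 < p) (hq : 0 < q) {c : Crossing (p, q)}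
    (h : c.left = c.right + (-1, 0)) :
    ∃ s, 0 < s ∧ s + 1 < p + q ∧ p ≤ offset p q s ∧
      c.left = leftPoint p q s ∧ c.right = rightPoint p q (s + 1) := by
  obtain ⟨⟨hlt, hle⟩, hs⟩ := (exists_horizontal_crossing_iff hp hq).1 ⟨c, h, rfl⟩
  obtain ⟨s, sum_eq⟩ : ∃ s : ℕ, c.right.1 + c.right.2 = (s + 1 : ℕ) :=
    ⟨(c.right.1 + c.right.2 - 1).toNat, by lia⟩
  have right_eq := eq_rightPoint sum_eq hle (by lia)
  have hoff : p ≤ offset p q s := by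
    by_contra! hoff
    rw [right_eq, planeDet_rightPoint, offset_succ_of_lt hoff] at hlt
    lia
  refine ⟨s, by lia, by lia, hoff, ?_, right_eq⟩
  rw [h, right_eq, leftPoint, rightPoint_succ_of_le hp hoff, add_assoc]
  rfl

/-- The left and the right endpoint of the `j`-th segment crossed by the curve of `(p, q)`, counted
from `0`. The curve crosses a diagonal segment on each antidiagonal, and a vertical or a horizontal
one between two antidiagonals. -/
def nthSegment (p q j : ℕ) : (ℤ × ℤ) × (ℤ × ℤ) :=
  if j % 2 = 0 then (leftPoint p q (j / 2 + 1), rightPoint p q (j / 2 + 1))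
  else if offset p q (j / 2 + 1) < p then
    (leftPoint p q (j / 2 + 2), rightPoint p q (j / 2 + 1))
  else (leftPoint p q (j / 2 + 1), rightPoint p q (j / 2 + 2))

lemma nthSegment_two_mul (i : ℕ) :
    nthSegment p q (2 * i) = (leftPoint p q (i + 1), rightPoint p q (i + 1)) := by
  simp [nthSegment]

lemma nthSegment_two_mul_add_one_of_lt {i : ℕ} (h : offset p q (i + 1) < p) :
    nthSegment p q (2 * i + 1) = (leftPoint p q (i + 2), rightPoint p q (i + 1)) := by
  simp [nthSegment, show (2 * i + 1) / 2 = i by lia, h]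

lemma nthSegment_two_mul_add_one_of_le {i : ℕ} (h : p ≤ offset p q (i + 1)) :
    nthSegment p q (2 * i + 1) = (leftPoint p q (i + 1), rightPoint p q (i + 2)) := by
  simp [nthSegment, show (2 * i + 1) / 2 = i by lia, h.not_gt]

lemma exists_crossing_eq_nthSegment (hp : 0 < p) (hq : 0 < q) {j : ℕ} (hj : j < 2 * (p + q) - 3) :
    ∃ c : Crossing (p, q), (c.left, c.right) = nthSegment p q j := by
  obtain ⟨i, rfl | rfl⟩ := j.even_or_odd'
  · simpa only [nthSegment_two_mul, Prod.mk.injEq] using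
      exists_diagonal_crossing hp i.succ_pos (by lia)
  · rcases lt_or_ge (offset p q (i + 1)) p with h | h
    · simpa only [nthSegment_two_mul_add_one_of_lt h, Prod.mk.injEq] using
        exists_vertical_crossing hp hq i.succ_pos (by lia) h
    · simpa only [nthSegment_two_mul_add_one_of_le h, Prod.mk.injEq] using
        exists_horizontal_crossing hp hq i.succ_pos (by lia) h

lemma Crossing.exists_eq_nthSegment (hp : 0 < p) (hq : 0 < q) (c : Crossing (p, q)) :
    ∃ j < 2 * (p + q) - 3, (c.left, c.right) = nthSegment p q j := by
  rcases c.left_eq (by simpa) (by simpa) with h | h | h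
  · obtain ⟨_ | i, hs, hlt, hoff, hl, hr⟩ := c.eq_of_left_eq_add_zero_one hp hq h
    · exact absurd hs (lt_irrefl 0)
    · exact ⟨2 * i + 1, by lia, by rw [hl, hr, nthSegment_two_mul_add_one_of_lt hoff]⟩
  · obtain ⟨_ | i, hs, hlt, hoff, hl, hr⟩ := c.eq_of_left_eq_add_neg_one_zero hp hq h
    · exact absurd hs (lt_irrefl 0)
    · exact ⟨2 * i + 1, by lia, by rw [hl, hr, nthSegment_two_mul_add_one_of_le hoff]⟩
  · obtain ⟨_ | i, hs, hlt, hl, hr⟩ := c.eq_of_left_eq_add_neg_one_one hp h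
    · exact absurd hs (lt_irrefl 0)
    · exact ⟨2 * i, by lia, by rw [hl, hr, nthSegment_two_mul]⟩

/-- The number, counted from `0`, of a crossing along the curve: the sum of the antidiagonals of its
two endpoints grows by one from each crossing to the next. -/
def Crossing.index {v : ℤ × ℤ} (c : Crossing v) : ℕ :=
  (c.left.1 + c.left.2 + (c.right.1 + c.right.2) - 2).toNat

lemma Crossing.index_eq {c : Crossing (p, q)} {j : ℕ}
    (h : (c.left, c.right) = nthSegment p q j) : c.index = j := by
  obtain ⟨hl, hr⟩ := Prod.ext_iff.1 h
  dsimp only at hl hr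
  rw [Crossing.index, hl, hr, nthSegment]
  split_ifs <;> simp only [leftPoint_fst_add_snd, rightPoint_fst_add_snd] <;> lia

lemma Crossing.index_lt (hp : 0 < p) (hq : 0 < q) (c : Crossing (p, q)) :
    c.index < 2 * (p + q) - 3 := by
  obtain ⟨j, hj, h⟩ := c.exists_eq_nthSegment hp hq
  rw [c.index_eq h]
  exact hj

lemma Crossing.eq_nthSegment_index (hp : 0 < p) (hq : 0 < q) (c : Crossing (p, q)) :
    (c.left, c.right) = nthSegment p q c.index := by
  obtain ⟨j, -, h⟩ := c.exists_eq_nthSegment hp hq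
  rwa [c.index_eq h]

/-- The enumeration of the crossings along the curve. -/
noncomputable def crossingEquiv (hp : 0 < p) (hq : 0 < q) :
    Crossing (p, q) ≃ Fin (2 * (p + q) - 3) :=
  Equiv.ofBijective (fun c => ⟨c.index, c.index_lt hp hq⟩) <| by
    refine ⟨fun c d h => ?_, fun j => ?_⟩
    · have segment_eq := c.eq_nthSegment_index hp hq
      rw [Fin.mk.inj h, ← d.eq_nthSegment_index hp hq] at segment_eq
      exact Crossing.ext (congrArg Prod.fst segment_eq) (congrArg Prod.snd segment_eq)
    · obtain ⟨c, hc⟩ := exists_crossing_eq_nthSegment hp hq j.2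
      exact ⟨c, Fin.ext (c.index_eq hc)⟩

lemma Crossing.index_injective (hp : 0 < p) (hq : 0 < q) :
    Function.Injective (Crossing.index : Crossing ((p : ℤ), (q : ℤ)) → ℕ) := fun _ _ h =>
  (crossingEquiv hp hq).injective (Fin.ext h)

end Crossings

section Positions

variable {p q : ℕ}

/-- The position along the curve of its crossing with the antidiagonal `x + y = s`. -/
def diagPosition (p q : ℕ) (s : ℤ) : ℚ ×ₗ ℚ := toLex ((s : ℚ) / (p + q), ((q : ℚ) - p) / (p + q))

lemma diagPosition_strictMono (hp : 0 < p) : StrictMono (diagPosition p q) := fun s t h => by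
  have : (0 : ℚ) < p + q := by positivity
  exact Prod.Lex.toLex_lt_toLex.2 (.inl (div_lt_div_of_pos_right (by exact_mod_cast h) this))

lemma Crossing.position_eq {v w : ℤ × ℤ} {c : Crossing v} (h : c.left = c.right + w) :
    c.position = toLex ((planeDet c.right w : ℚ) / planeDet v w,
      (planeDot v w : ℚ) / planeDet v w) := by
  rw [Crossing.position, h, hitTime_add_left, hitDrift_add_left]

lemma Crossing.position_of_left_eq_add_neg_one_one {c : Crossing (p, q)}
    (h : c.left = c.right + (-1, 1)) :
    c.position = diagPosition p q (c.right.1 + c.right.2) := by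
  simp only [c.position_eq h, diagPosition, planeDet, planeDot]
  push_cast
  ring_nf

lemma Crossing.position_of_left_eq_add_zero_one (hp : 0 < p) {c : Crossing (p, q)}
    (h : c.left = c.right + (0, 1)) :
    diagPosition p q (c.right.1 + c.right.2) < c.position ∧
      c.position < diagPosition p q (c.right.1 + c.right.2 + 1) := by
  have hpQ : (0 : ℚ) < p := by exact_mod_cast hp
  have hpqQ : (0 : ℚ) < p + q := by positivity
  have hl := c.left_pos
  have hr : (p * c.right.2 - q * c.right.1 : ℚ) ≤ 0 := by exact_mod_cast c.right_nonpos
  rw [h, planeDet_add] at hl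
  have hl : (0 : ℚ) < p * c.right.2 - q * c.right.1 + p := by
    simpa [planeDet] using (Int.cast_pos (R := ℚ)).2 hl
  simp only [c.position_eq h, diagPosition, planeDet, planeDot, mul_zero, mul_one, sub_zero,
    zero_add]
  push_cast
  constructor
  · rw [Prod.Lex.toLex_lt_toLex', div_le_div_iff₀ hpqQ hpQ, div_lt_div_iff₀ hpqQ hpQ]
    exact ⟨by linarith, fun _ => by nlinarith⟩
  · rw [Prod.Lex.toLex_lt_toLex, div_lt_div_iff₀ hpQ hpqQ]
    exact .inl (by linarith)

lemma Crossing.position_of_left_eq_add_neg_one_zero (hq : 0 < q) {c : Crossing (p, q)}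
    (h : c.left = c.right + (-1, 0)) :
    diagPosition p q (c.right.1 + c.right.2 - 1) < c.position ∧
      c.position < diagPosition p q (c.right.1 + c.right.2) := by
  have hqQ : (0 : ℚ) < q := by exact_mod_cast hq
  have hpqQ : (0 : ℚ) < p + q := by positivity
  have hl := c.left_pos
  have hr : (p * c.right.2 - q * c.right.1 : ℚ) ≤ 0 := by exact_mod_cast c.right_nonpos
  rw [h, planeDet_add] at hl
  have hl : (0 : ℚ) < p * c.right.2 - q * c.right.1 + q := by
    simpa [planeDet] using (Int.cast_pos (R := ℚ)).2 hl
  simp only [c.position_eq h, diagPosition, planeDet, planeDot, mul_zero, mul_one, mul_neg,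
    zero_sub, neg_neg, add_zero]
  push_cast
  constructor
  · rw [Prod.Lex.toLex_lt_toLex, div_lt_div_iff₀ hpqQ hqQ]
    exact .inl (by linarith)
  · rw [Prod.Lex.toLex_lt_toLex', div_le_div_iff₀ hqQ hpqQ, div_lt_div_iff₀ hqQ hpqQ]
    exact ⟨by linarith, fun _ => by nlinarith⟩

lemma Crossing.position_of_index_eq_two_mul (hp : 0 < p) (hq : 0 < q) {c : Crossing (p, q)} {i : ℕ}
    (h : c.index = 2 * i) : c.position = diagPosition p q (i + 1) := by
  have segment_eq := c.eq_nthSegment_index hp hq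
  rw [h, nthSegment_two_mul, Prod.mk.injEq] at segment_eq
  rw [c.position_of_left_eq_add_neg_one_one (by rw [segment_eq.1, segment_eq.2, leftPoint]),
    segment_eq.2, rightPoint_fst_add_snd, Nat.cast_succ]

lemma Crossing.position_of_index_eq_two_mul_add_one (hp : 0 < p) (hq : 0 < q)
    {c : Crossing (p, q)} {i : ℕ} (h : c.index = 2 * i + 1) :
    diagPosition p q (i + 1) < c.position ∧ c.position < diagPosition p q (i + 2) := by
  have segment_eq := c.eq_nthSegment_index hp hq
  rw [h] at segment_eq
  rcases lt_or_ge (offset p q (i + 1)) p with hoff | hoff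
  · rw [nthSegment_two_mul_add_one_of_lt hoff, Prod.mk.injEq] at segment_eq
    have := c.position_of_left_eq_add_zero_one hp
      (by rw [segment_eq.1, segment_eq.2, leftPoint, rightPoint_succ_of_lt hoff, add_assoc]; rfl)
    rw [segment_eq.2, rightPoint_fst_add_snd] at this
    exact_mod_cast this
  · rw [nthSegment_two_mul_add_one_of_le hoff, Prod.mk.injEq] at segment_eq
    have := c.position_of_left_eq_add_neg_one_zero hq
      (by rw [segment_eq.1, segment_eq.2, leftPoint, rightPoint_succ_of_le hp hoff, add_assoc]; rfl)
    rw [segment_eq.2, rightPoint_fst_add_snd] at this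
    convert this using 3 <;> push_cast <;> ring

lemma Crossing.position_lt_of_index_lt (hp : 0 < p) (hq : 0 < q) {c d : Crossing (p, q)}
    (h : c.index < d.index) : c.position < d.position := by
  have mono := (diagPosition_strictMono (q := q) hp).monotone
  obtain ⟨i, hi | hi⟩ := c.index.even_or_odd' <;> obtain ⟨j, hj | hj⟩ := d.index.even_or_odd'
  · rw [position_of_index_eq_two_mul hp hq hi, position_of_index_eq_two_mul hp hq hj]
    exact diagPosition_strictMono hp (by lia)
  · rw [position_of_index_eq_two_mul hp hq hi]
    exact (mono (by lia)).trans_lt (position_of_index_eq_two_mul_add_one hp hq hj).1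
  · rw [position_of_index_eq_two_mul hp hq hj]
    exact (position_of_index_eq_two_mul_add_one hp hq hi).2.trans_le (mono (by lia))
  · exact (position_of_index_eq_two_mul_add_one hp hq hi).2.trans_le
      ((mono (by lia)).trans (position_of_index_eq_two_mul_add_one hp hq hj).1.le)

lemma Crossing.position_lt_iff (hp : 0 < p) (hq : 0 < q) {c d : Crossing (p, q)} :
    c.position < d.position ↔ c.index < d.index := by
  refine ⟨fun h => ?_, position_lt_of_index_lt hp hq⟩
  by_contra! hle
  rcases hle.eq_or_lt with heq | hlt
  · exact h.ne (congrArg Crossing.position (index_injective hp hq heq).symm)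
  · exact h.asymm (position_lt_of_index_lt hp hq hlt)

lemma Crossing.consecutive_iff (hp : 0 < p) (hq : 0 < q) {c d : Crossing (p, q)} :
    c.Consecutive d ↔ d.index = c.index + 1 := by
  simp only [Crossing.Consecutive, position_lt_iff hp hq]
  refine ⟨fun ⟨_, hbetween⟩ => ?_, fun h => ⟨by lia, fun e => by lia⟩⟩
  by_contra! hne
  have := d.index_lt hp hq
  obtain ⟨e, he⟩ := (crossingEquiv hp hq).surjective ⟨c.index + 1, by lia⟩
  have e_index : e.index = c.index + 1 := congrArg Fin.val he
  exact hbetween e (by lia)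

end Positions

section Fence

variable {p q : ℕ}

/-- The chain on the `j`-th crossed segment goes down: its right endpoint is the closer one. -/
def chainDown (p q j : ℕ) : Bool :=
  decide (|planeDet (p, q) (nthSegment p q j).2| < |planeDet (p, q) (nthSegment p q j).1|)

/-- The fence goes down from the `j`-th to the next crossed segment: they have the same right
endpoint. -/
def linkDown (p q j : ℕ) : Bool := decide ((nthSegment p q j).2 = (nthSegment p q (j + 1)).2)

lemma Crossing.closerToRight_iff (hp : 0 < p) (hq : 0 < q) {c : Crossing (p, q)} :
    c.CloserToRight ↔ chainDown p q c.index = true := by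
  rw [chainDown, ← c.eq_nthSegment_index hp hq, decide_eq_true_eq, CloserToRight]

lemma chainDown_two_mul (hp : 0 < p) (i : ℕ) :
    chainDown p q (2 * i) = decide (2 * offset p q (i + 1) < p + q) := by
  have := offset_lt (q := q) hp (i + 1)
  rw [chainDown, nthSegment_two_mul, planeDet_rightPoint, planeDet_leftPoint, abs_neg,
    Nat.abs_cast, abs_of_pos (by lia), decide_eq_decide]
  lia

lemma chainDown_two_mul_add_one_of_lt {i : ℕ} (h : offset p q (i + 1) < p) :
    chainDown p q (2 * i + 1) = decide (2 * offset p q (i + 1) < p) := by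
  rw [chainDown, nthSegment_two_mul_add_one_of_lt h, planeDet_rightPoint, planeDet_leftPoint,
    offset_succ_of_lt h, abs_neg, Nat.abs_cast, abs_of_pos (by lia), decide_eq_decide]
  lia

lemma chainDown_two_mul_add_one_of_le (hp : 0 < p) {i : ℕ} (h : p ≤ offset p q (i + 1)) :
    chainDown p q (2 * i + 1) = decide (2 * offset p q (i + 1) < 2 * p + q) := by
  have := offset_lt (q := q) hp (i + 1)
  rw [chainDown, nthSegment_two_mul_add_one_of_le h, planeDet_rightPoint, planeDet_leftPoint,
    offset_succ_of_le hp h, abs_neg, Nat.abs_cast, abs_of_pos (by lia), decide_eq_decide]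
  lia

lemma linkDown_two_mul (i : ℕ) : linkDown p q (2 * i) = decide (offset p q (i + 1) < p) := by
  rcases lt_or_ge (offset p q (i + 1)) p with h | h
  · simp [linkDown, nthSegment_two_mul, nthSegment_two_mul_add_one_of_lt h, h]
  · simp [linkDown, nthSegment_two_mul, nthSegment_two_mul_add_one_of_le h, h.not_gt,
      rightPoint_injective.eq_iff]

lemma linkDown_two_mul_add_one (i : ℕ) :
    linkDown p q (2 * i + 1) = decide (p ≤ offset p q (i + 1)) := by
  rw [linkDown, show 2 * i + 1 + 1 = 2 * (i + 1) by lia, nthSegment_two_mul]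
  rcases lt_or_ge (offset p q (i + 1)) p with h | h
  · simp [nthSegment_two_mul_add_one_of_lt h, h.not_ge, rightPoint_injective.eq_iff]
  · simp [nthSegment_two_mul_add_one_of_le h, h]

lemma nthSegment_fst_eq_succ_iff (j : ℕ) :
    (nthSegment p q j).1 = (nthSegment p q (j + 1)).1 ↔
      (nthSegment p q j).2 ≠ (nthSegment p q (j + 1)).2 := by
  obtain ⟨i, rfl | rfl⟩ := j.even_or_odd' <;>
    rcases lt_or_ge (offset p q (i + 1)) p with h | h
  all_goals
    simp [nthSegment_two_mul, nthSegment_two_mul_add_one_of_lt, nthSegment_two_mul_add_one_of_le, h,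
      show 2 * i + 1 + 1 = 2 * (i + 1) by lia, rightPoint_injective.eq_iff,
      leftPoint_injective.eq_iff]

lemma Crossing.right_eq_iff (hp : 0 < p) (hq : 0 < q) {c d : Crossing (p, q)}
    (h : d.index = c.index + 1) : c.right = d.right ↔ linkDown p q c.index = true := by
  rw [linkDown, ← h, ← c.eq_nthSegment_index hp hq, ← d.eq_nthSegment_index hp hq,
    decide_eq_true_eq]

lemma Crossing.left_eq_iff (hp : 0 < p) (hq : 0 < q) {c d : Crossing (p, q)}
    (h : d.index = c.index + 1) : c.left = d.left ↔ linkDown p q c.index = false := by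
  have := nthSegment_fst_eq_succ_iff (p := p) (q := q) c.index
  rw [← h, ← c.eq_nthSegment_index hp hq, ← d.eq_nthSegment_index hp hq] at this
  rw [this, ne_eq, right_eq_iff hp hq h, Bool.not_eq_true]

/-- The fence goes down from its `t`-th to its `(t + 1)`-st element, that is from
`(τ, t % (k + 1))` on, where `τ` is the crossed segment with number `t / (k + 1)`. -/
def fenceDown (k p q t : ℕ) : Bool :=
  if t % (k + 1) < k then chainDown p q (t / (k + 1)) else linkDown p q (t / (k + 1))

lemma fenceDown_add_mul_of_lt {k i : ℕ} (h : i < k) (j : ℕ) :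
    fenceDown k p q (i + (k + 1) * j) = chainDown p q j := by
  rw [fenceDown, Nat.add_mul_mod_self_left, Nat.add_mul_div_left _ _ k.add_one_pos,
    Nat.mod_eq_of_lt (by lia), Nat.div_eq_of_lt (by lia), if_pos h, zero_add]

lemma fenceDown_self_add_mul (k j : ℕ) :
    fenceDown k p q (k + (k + 1) * j) = linkDown p q j := by
  rw [fenceDown, Nat.add_mul_mod_self_left, Nat.add_mul_div_left _ _ k.add_one_pos,
    Nat.mod_eq_of_lt k.lt_add_one, Nat.div_eq_of_lt k.lt_add_one, if_neg (lt_irrefl k), zero_add]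

/-- The enumeration of the fence: the elements on one crossed segment, then those on the next. -/
noncomputable def fenceEquiv (hp : 0 < p) (hq : 0 < q) (k : ℕ) :
    Crossing (p, q) × Fin (k + 1) ≃ Fin ((2 * (p + q) - 3) * (k + 1)) :=
  ((crossingEquiv hp hq).prodCongr (Equiv.refl _)).trans finProdFinEquiv

lemma val_fenceEquiv (hp : 0 < p) (hq : 0 < q) {k : ℕ} (x : Crossing (p, q) × Fin (k + 1)) :
    (fenceEquiv hp hq k x : ℕ) = x.2 + (k + 1) * x.1.index := rfl

lemma add_mul_eq_succ_iff {k a b i j : ℕ} (hi : i ≤ k) (hj : j ≤ k) :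
    j + (k + 1) * b = i + (k + 1) * a + 1 ↔
      (b = a ∧ j = i + 1) ∨ (b = a + 1 ∧ i = k ∧ j = 0) := by
  refine ⟨fun h => ?_, ?_⟩
  · have hab : a ≤ b := by nlinarith
    have hba : b ≤ a + 1 := by nlinarith
    obtain rfl | rfl : b = a ∨ b = a + 1 := by lia
    · exact .inl ⟨rfl, by lia⟩
    · rw [mul_add_one] at h
      exact .inr ⟨rfl, by lia, by lia⟩
  · rintro (⟨rfl, rfl⟩ | ⟨rfl, rfl, rfl⟩) <;> ring

lemma fenceEquiv_eq_succ_and_fenceDown_iff (hp : 0 < p) (hq : 0 < q) {k : ℕ} (d : Bool)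
    (x y : Crossing (p, q) × Fin (k + 1)) :
    ((fenceEquiv hp hq k y : ℕ) = fenceEquiv hp hq k x + 1 ∧
        fenceDown k p q (fenceEquiv hp hq k x) = d) ↔
      (x.1 = y.1 ∧ (y.2 : ℕ) = x.2 + 1 ∧ chainDown p q x.1.index = d) ∨
        (y.1.index = x.1.index + 1 ∧ (x.2 : ℕ) = k ∧ (y.2 : ℕ) = 0 ∧
          linkDown p q x.1.index = d) := by
  rw [val_fenceEquiv, val_fenceEquiv, add_mul_eq_succ_iff x.2.is_le y.2.is_le,
    (Crossing.index_injective hp hq).eq_iff, or_and_right, and_assoc, and_assoc, and_assoc,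
    eq_comm (a := y.1)]
  refine or_congr (and_congr_right fun _ => and_congr_right fun hxy => ?_)
    (and_congr_right fun _ => and_congr_right fun hx => ?_)
  · rw [fenceDown_add_mul_of_lt (by lia)]
  · rw [hx, fenceDown_self_add_mul]

lemma fenceRel_iff {k : ℕ} {v : ℤ × ℤ} {x y : Crossing v × Fin (k + 1)} :
    FenceRel k v x y ↔
      ((y.1 = x.1 ∧ (x.2 : ℕ) = y.2 + 1 ∧ y.1.CloserToRight) ∨
        (y.1.Consecutive x.1 ∧ (y.2 : ℕ) = k ∧ (x.2 : ℕ) = 0 ∧ y.1.right = x.1.right)) ∨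
      ((x.1 = y.1 ∧ (y.2 : ℕ) = x.2 + 1 ∧ ¬ x.1.CloserToRight) ∨
        (x.1.Consecutive y.1 ∧ (x.2 : ℕ) = k ∧ (y.2 : ℕ) = 0 ∧ x.1.left = y.1.left)) := by
  constructor
  · rintro (⟨c, i, h⟩ | ⟨c, i, h⟩ | ⟨c, c', h, h'⟩ | ⟨c, c', h, h'⟩)
    · exact .inl (.inl ⟨rfl, by simp, h⟩)
    · exact .inr (.inl ⟨rfl, by simp, h⟩)
    · exact .inl (.inr ⟨h, by simp, by simp, h'⟩)
    · exact .inr (.inr ⟨h, by simp, by simp, h'⟩)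
  · obtain ⟨c, i⟩ := x
    obtain ⟨c', i'⟩ := y
    dsimp only
    rintro ((⟨rfl, hi, h⟩ | ⟨h, hi', hi, h'⟩) | (⟨rfl, hi, h⟩ | ⟨h, hi, hi', h'⟩))
    · obtain ⟨j, rfl⟩ : ∃ j : Fin k, i' = j.castSucc := ⟨⟨i', by lia⟩, rfl⟩
      obtain rfl : i = j.succ := Fin.ext hi
      exact .chainDown _ _ h
    · obtain rfl : i' = Fin.last k := Fin.ext hi'
      obtain rfl : i = 0 := Fin.ext hi
      exact .linkDown _ _ h h'
    · obtain ⟨j, rfl⟩ : ∃ j : Fin k, i = j.castSucc := ⟨⟨i, by lia⟩, rfl⟩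
      obtain rfl : i' = j.succ := Fin.ext hi
      exact .chainUp _ _ h
    · obtain rfl : i = Fin.last k := Fin.ext hi
      obtain rfl : i' = 0 := Fin.ext hi'
      exact .linkUp _ _ h h'

lemma isFenceAlong_fenceRel (hp : 0 < p) (hq : 0 < q) (k : ℕ) :
    IsFenceAlong (FenceRel k (p, q)) (fenceEquiv hp hq k) (fenceDown k p q) := fun x y => by
  rw [fenceRel_iff, fenceEquiv_eq_succ_and_fenceDown_iff, fenceEquiv_eq_succ_and_fenceDown_iff]
  simp only [Crossing.consecutive_iff hp hq, Crossing.closerToRight_iff hp hq, Bool.not_eq_true]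
  refine or_congr (or_congr_right (and_congr_right fun hindex => ?_))
    (or_congr_right (and_congr_right fun hindex => ?_))
  · rw [Crossing.right_eq_iff hp hq hindex]
  · rw [Crossing.left_eq_iff hp hq hindex]

lemma genMarkov_eq_entrySum_fenceDown (hp : 0 < p) (hq : 0 < q) (k : ℕ) :
    (genMarkov k p q : ℝ) = entrySum ℝ ((List.range ((k + 1) * (2 * (p + q) - 4) + k)).map
      fun t => stepMatrix ℝ (fenceDown k p q t)).prod := by
  have card_eq : (2 * (p + q) - 3) * (k + 1) = (k + 1) * (2 * (p + q) - 4) + k + 1 := by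
    rw [show 2 * (p + q) - 3 = 2 * (p + q) - 4 + 1 by lia]
    ring
  have fence : IsFenceAlong (FenceRel k (p, q)) ((fenceEquiv hp hq k).trans (finCongr card_eq))
      (fenceDown k p q) := isFenceAlong_fenceRel hp hq k
  exact fence.ncard_ideals ℝ

end Fence

section TransferMatrices

variable {p q : ℕ}

/-- The transfer matrix of the chain on one crossed segment. -/
def chainMatrix (k : ℕ) (down : Bool) : Matrix (Fin 2) (Fin 2) ℝ := stepMatrix ℝ down ^ k

/-- The transfer matrix of the chain on the crossed segment of the antidiagonal `x + y = s`. -/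
def diagMatrix (k p q s : ℕ) : Matrix (Fin 2) (Fin 2) ℝ :=
  chainMatrix k (decide (2 * offset p q s < p + q))

/-- The transfer matrix of the chain on a crossed vertical segment, with the links before and after
it. -/
def verticalMatrix (k : ℕ) (down : Bool) : Matrix (Fin 2) (Fin 2) ℝ :=
  stepMatrix ℝ true * chainMatrix k down * stepMatrix ℝ false

/-- The transfer matrix of the chain on a crossed horizontal segment, with the links before and
after it. -/
def horizontalMatrix (k : ℕ) (down : Bool) : Matrix (Fin 2) (Fin 2) ℝ :=
  stepMatrix ℝ false * chainMatrix k down * stepMatrix ℝ true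

/-- The transfer matrix of the crossed segment between the antidiagonals `x + y = s` and
`x + y = s + 1`, which is vertical or horizontal. -/
def sideMatrix (k p q s : ℕ) : Matrix (Fin 2) (Fin 2) ℝ :=
  if offset p q s < p then verticalMatrix k (decide (2 * offset p q s < p))
  else horizontalMatrix k (decide (2 * offset p q s < 2 * p + q))

/-- The transfer matrix of the part of the fence from the antidiagonal `x + y = s` to the next
one. -/
def cellMatrix (k p q s : ℕ) : Matrix (Fin 2) (Fin 2) ℝ := diagMatrix k p q s * sideMatrix k p q s

/-- The transfer matrix of the fence of `(p, q)`. -/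
def fenceMatrix (k p q : ℕ) : Matrix (Fin 2) (Fin 2) ℝ :=
  ((List.range (p + q - 2)).map fun i => cellMatrix k p q (i + 1)).prod *
    diagMatrix k p q (p + q - 1)

lemma prod_stepMatrix_fenceDown_chain (k j : ℕ) :
    ((List.range k).map fun i => stepMatrix ℝ (fenceDown k p q ((k + 1) * j + i))).prod =
      chainMatrix k (chainDown p q j) := by
  rw [chainMatrix, ← prod_range_const]
  exact prod_range_congr fun i hi => by rw [add_comm, fenceDown_add_mul_of_lt hi]

lemma prod_stepMatrix_fenceDown (k n : ℕ) :
    ((List.range ((k + 1) * n)).map fun t => stepMatrix ℝ (fenceDown k p q t)).prod =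
      ((List.range n).map fun j =>
        chainMatrix k (chainDown p q j) * stepMatrix ℝ (linkDown p q j)).prod := by
  rw [prod_range_mul]
  refine prod_range_congr fun j _ => ?_
  rw [List.prod_range_succ, prod_stepMatrix_fenceDown_chain, add_comm, fenceDown_self_add_mul]

lemma chainMatrix_chainDown_two_mul (hp : 0 < p) (k i : ℕ) :
    chainMatrix k (chainDown p q (2 * i)) = diagMatrix k p q (i + 1) := by
  rw [diagMatrix, chainDown_two_mul hp]

lemma sideMatrix_eq (hp : 0 < p) (k i : ℕ) :
    stepMatrix ℝ (linkDown p q (2 * i)) * chainMatrix k (chainDown p q (2 * i + 1)) *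
      stepMatrix ℝ (linkDown p q (2 * i + 1)) = sideMatrix k p q (i + 1) := by
  rw [linkDown_two_mul, linkDown_two_mul_add_one, sideMatrix]
  rcases lt_or_ge (offset p q (i + 1)) p with h | h
  · rw [chainDown_two_mul_add_one_of_lt h, if_pos h, decide_eq_true h, decide_eq_false h.not_ge,
      verticalMatrix]
  · rw [chainDown_two_mul_add_one_of_le hp h, if_neg h.not_gt, decide_eq_false h.not_gt,
      decide_eq_true h, horizontalMatrix]

lemma genMarkov_eq_entrySum_fenceMatrix (hp : 0 < p) (hq : 0 < q) (k : ℕ) :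
    (genMarkov k p q : ℝ) = entrySum ℝ (fenceMatrix k p q) := by
  rw [genMarkov_eq_entrySum_fenceDown hp hq, prod_range_add, prod_stepMatrix_fenceDown,
    prod_stepMatrix_fenceDown_chain, show 2 * (p + q) - 4 = 2 * (p + q - 2) by lia,
    chainMatrix_chainDown_two_mul hp, show p + q - 2 + 1 = p + q - 1 by lia, fenceMatrix,
    prod_range_mul]
  congr 2
  refine prod_range_congr fun i _ => ?_
  rw [List.prod_range_succ, List.prod_range_succ, List.range_zero, List.map_nil, List.prod_nil,
    one_mul, add_zero, chainMatrix_chainDown_two_mul hp, cellMatrix, ← sideMatrix_eq hp]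
  simp only [mul_assoc]

lemma stepMatrix_true (R : Type*) [Semiring R] : stepMatrix R true = !![1, 1; 0, 1] := if_pos rfl

lemma stepMatrix_false (R : Type*) [Semiring R] : stepMatrix R false = !![1, 0; 1, 1] :=
  if_neg Bool.false_ne_true

lemma chainMatrix_true (k : ℕ) : chainMatrix k true = !![1, (k : ℝ); 0, 1] := by
  rw [chainMatrix, stepMatrix_true]
  induction k with
  | zero => simp [Matrix.one_fin_two]
  | succ k ih => simp [pow_succ, ih, add_comm]

lemma chainMatrix_false (k : ℕ) : chainMatrix k false = !![1, 0; (k : ℝ), 1] := by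
  rw [chainMatrix, stepMatrix_false]
  induction k with
  | zero => simp [Matrix.one_fin_two]
  | succ k ih => simp [pow_succ, ih]

lemma det_stepMatrix (R : Type*) [CommRing R] (down : Bool) : (stepMatrix R down).det = 1 := by
  cases down <;> simp [stepMatrix, Matrix.det_fin_two]

lemma det_chainMatrix (k : ℕ) (down : Bool) : (chainMatrix k down).det = 1 := by
  rw [chainMatrix, Matrix.det_pow, det_stepMatrix, one_pow]

lemma det_cellMatrix (k p q s : ℕ) : (cellMatrix k p q s).det = 1 := by
  rw [cellMatrix, diagMatrix, sideMatrix, verticalMatrix, horizontalMatrix]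
  split_ifs <;> simp only [Matrix.det_mul, det_stepMatrix, det_chainMatrix, mul_one]

lemma det_fenceMatrix (k p q : ℕ) : (fenceMatrix k p q).det = 1 := by
  rw [fenceMatrix, Matrix.det_mul, diagMatrix, det_chainMatrix, mul_one, ← Matrix.coe_detMonoidHom,
    map_list_prod, List.map_map]
  exact List.prod_eq_one (by simp [det_cellMatrix])

end TransferMatrices

section Multiples

variable {a b : ℕ}

lemma offset_mul_mul {d : ℕ} (s : ℕ) : offset (d * a) (d * b) s = d * offset a b s := by
  rw [offset, ← mul_add, mul_assoc, Nat.mul_mod_mul_left, offset]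

lemma offset_periodic (a b : ℕ) : Function.Periodic (offset a b) (a + b) := fun s => by
  rw [offset, mul_add, Nat.add_mul_mod_self_right, offset]

lemma offset_add_self (a b : ℕ) : offset a b (a + b) = 0 := Nat.mul_mod_left _ _

lemma offset_add_sub_one (ha : 0 < a) (hb : 0 < b) : offset a b (a + b - 1) = a := by
  have last := offset_add_self a b
  rw [show a + b = a + b - 1 + 1 by lia] at last
  rcases lt_or_ge (offset a b (a + b - 1)) a with h | h
  · rw [offset_succ_of_lt h] at last
    lia
  · rw [offset_succ_of_le ha h] at last
    lia

lemma diagMatrix_mul_mul (k : ℕ) {d : ℕ} (hd : 0 < d) (s : ℕ) :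
    diagMatrix k (d * a) (d * b) s = diagMatrix k a b s := by
  simp only [diagMatrix, offset_mul_mul, ← mul_add, mul_left_comm 2 d, Nat.mul_lt_mul_left hd]

lemma cellMatrix_mul_mul (k : ℕ) {d : ℕ} (hd : 0 < d) (s : ℕ) :
    cellMatrix k (d * a) (d * b) s = cellMatrix k a b s := by
  simp only [cellMatrix, diagMatrix_mul_mul k hd, sideMatrix, offset_mul_mul, ← mul_add,
    mul_left_comm 2 d, Nat.mul_lt_mul_left hd]

lemma diagMatrix_periodic (k a b : ℕ) : Function.Periodic (diagMatrix k a b) (a + b) := fun s => by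
  rw [diagMatrix, offset_periodic, diagMatrix]

lemma cellMatrix_periodic (k a b : ℕ) : Function.Periodic (cellMatrix k a b) (a + b) := fun s => by
  rw [cellMatrix, diagMatrix_periodic, sideMatrix, offset_periodic, cellMatrix, sideMatrix]

/-- The transfer matrix of the three crossings on a detour around a lattice point on the line, with
the links before and after each of them. -/
def detourMatrix (k : ℕ) : Matrix (Fin 2) (Fin 2) ℝ :=
  !![3 * (k : ℝ) + 3, 3 * k + 2; 3 * k + 4, 3 * k + 3]

lemma detourMatrix_eq (k : ℕ) :
    detourMatrix k = horizontalMatrix k true * chainMatrix k true * verticalMatrix k true := by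
  simp only [detourMatrix, horizontalMatrix, verticalMatrix, stepMatrix_true, stepMatrix_false,
    chainMatrix_true, Matrix.mul_fin_two]
  ring_nf

lemma prod_cellMatrix_add (k : ℕ) (ha : 0 < a) (hb : 0 < b) :
    ((List.range (a + b)).map fun i => cellMatrix k a b (i + 1)).prod =
      fenceMatrix k a b * detourMatrix k := by
  have side_last : sideMatrix k a b (a + b - 1) = horizontalMatrix k true := by
    rw [sideMatrix, offset_add_sub_one ha hb, if_neg (lt_irrefl a), decide_eq_true (by lia)]
  have diag_detour : diagMatrix k a b (a + b) = chainMatrix k true := by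
    rw [diagMatrix, offset_add_self, decide_eq_true (by lia)]
  have side_detour : sideMatrix k a b (a + b) = verticalMatrix k true := by
    rw [sideMatrix, offset_add_self, if_pos ha, decide_eq_true (by lia)]
  obtain ⟨n, hn⟩ : ∃ n, a + b = n + 2 := ⟨a + b - 2, by lia⟩
  rw [fenceMatrix, detourMatrix_eq, ← side_last, ← side_detour, ← diag_detour, hn,
    List.prod_range_succ, List.prod_range_succ]
  simp only [cellMatrix, Nat.add_sub_cancel, Nat.add_succ_sub_one, mul_assoc]

lemma fenceMatrix_mul_mul (k : ℕ) (ha : 0 < a) (hb : 0 < b) (d : ℕ) :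
    fenceMatrix k ((d + 1) * a) ((d + 1) * b) =
      (fenceMatrix k a b * detourMatrix k) ^ d * fenceMatrix k a b := by
  have shift_eq (e : ℕ) (he : e ≤ a + b) :
      (d + 1) * a + (d + 1) * b - e = (a + b) * d + (a + b - e) := by
    rw [← mul_add, mul_comm, mul_add_one]
    lia
  have cell_periodic : Function.Periodic (fun i => cellMatrix k a b (i + 1)) (a + b) :=
    (cellMatrix_periodic k a b).add_const 1
  have cell_eq (i : ℕ) : cellMatrix k a b ((a + b) * d + i + 1) = cellMatrix k a b (i + 1) := by
    rw [add_assoc, add_comm, mul_comm, ← smul_eq_mul, (cellMatrix_periodic k a b).nsmul]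
  have diag_eq : diagMatrix k a b ((a + b) * d + (a + b - 1)) = diagMatrix k a b (a + b - 1) := by
    rw [add_comm, mul_comm, ← smul_eq_mul, (diagMatrix_periodic k a b).nsmul]
  rw [fenceMatrix, shift_eq 2 (by lia), shift_eq 1 (by lia), diagMatrix_mul_mul k d.succ_pos,
    diag_eq]
  simp only [cellMatrix_mul_mul k d.succ_pos]
  rw [prod_range_add, prod_range_mul_of_periodic cell_periodic, prod_cellMatrix_add k ha hb]
  simp only [cell_eq, mul_assoc, fenceMatrix]

end Multiples

section Chebyshev

open Polynomial Chebyshev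

variable {R : Type*} [CommRing R]

lemma pow_add_two_of_det_eq_one {N : Matrix (Fin 2) (Fin 2) R} (h : N.det = 1) (d : ℕ) :
    N ^ (d + 2) = N.trace • N ^ (d + 1) - N ^ d := by
  have sq_eq : N ^ 2 = N.trace • N - 1 := by
    rcases subsingleton_or_nontrivial R with _ | _
    · exact Subsingleton.elim _ _
    · have cayley_hamilton := N.aeval_self_charpoly
      rwa [N.charpoly_fin_two, h, map_one, map_add, map_sub, map_mul, map_pow, aeval_X,
        Polynomial.aeval_C, map_one, ← Algebra.smul_def, sub_add, sub_eq_zero] at cayley_hamilton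
  rw [pow_add, sq_eq, mul_sub, mul_smul_comm, ← pow_succ, mul_one]

lemma entrySum_pow_mul {M N : Matrix (Fin 2) (Fin 2) R} (hdet : N.det = 1)
    (hmul : entrySum R (N * M) = N.trace * entrySum R M) (d : ℕ) :
    entrySum R (N ^ d * M) = entrySum R M * (S R d).eval N.trace := by
  induction d using Nat.twoStepInduction with
  | zero => simp
  | one => simp [hmul, mul_comm]
  | more d ih ih' =>
    rw [pow_add_two_of_det_eq_one hdet, sub_mul, smul_mul_assoc, map_sub, map_smul, ih, ih']
    push_cast
    rw [S_add_two, eval_sub, eval_mul, eval_X, smul_eq_mul]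
    ring

lemma det_detourMatrix (k : ℕ) : (detourMatrix k).det = 1 := by
  rw [detourMatrix, Matrix.det_fin_two_of]
  ring

lemma trace_mul_detourMatrix {k : ℕ} {M : Matrix (Fin 2) (Fin 2) ℝ}
    (h : M 0 1 - M 1 0 = -k) :
    (M * detourMatrix k).trace = (3 + 3 * k) * entrySum ℝ M - k := by
  rw [M.eta_fin_two, detourMatrix, Matrix.mul_fin_two, Matrix.trace_fin_two_of, entrySum_of]
  linear_combination h

lemma entrySum_mul_detourMatrix_mul {k : ℕ} {M : Matrix (Fin 2) (Fin 2) ℝ}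
    (h : M 0 1 - M 1 0 = -k) :
    entrySum ℝ (M * detourMatrix k * M) = (M * detourMatrix k).trace * entrySum ℝ M := by
  rw [trace_mul_detourMatrix h, M.eta_fin_two, detourMatrix, Matrix.mul_fin_two,
    Matrix.mul_fin_two, entrySum_of, entrySum_of]
  linear_combination (M 0 0 + M 0 1 + (M 1 0 + M 1 1)) * h

theorem genMarkov_mul_mul {k a b : ℕ} (ha : 0 < a) (hb : 0 < b)
    (h : fenceMatrix k a b 0 1 - fenceMatrix k a b 1 0 = -k) (d : ℕ) :
    (genMarkov k ((d + 1) * a) ((d + 1) * b) : ℝ) =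
      genMarkov k a b * (S ℝ d).eval ((3 + 3 * k) * (genMarkov k a b : ℝ) - k) := by
  have det_eq : (fenceMatrix k a b * detourMatrix k).det = 1 := by
    rw [Matrix.det_mul, det_fenceMatrix, det_detourMatrix, one_mul]
  rw [genMarkov_eq_entrySum_fenceMatrix ha hb, ← trace_mul_detourMatrix h,
    ← entrySum_pow_mul det_eq (entrySum_mul_detourMatrix_mul h), ← fenceMatrix_mul_mul k ha hb,
    ← genMarkov_eq_entrySum_fenceMatrix (by positivity) (by positivity)]
  push_cast
  rfl

lemma tendsto_eval_S_div_pow (d : ℕ) :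
    Tendsto (fun x : ℝ => (S ℝ d).eval x / x ^ d) atTop (𝓝 1) := by
  induction d using Nat.twoStepInduction with
  | zero => simp
  | one =>
    refine tendsto_const_nhds.congr' ?_
    filter_upwards [eventually_ne_atTop 0] with x hx
    simp [hx]
  | more d ih ih' =>
    have limit := ih'.sub (ih.mul (tendsto_inv_atTop_zero.comp (tendsto_pow_atTop two_ne_zero)))
    rw [mul_zero, sub_zero] at limit
    refine limit.congr' ?_
    filter_upwards [eventually_ne_atTop 0] with x hx
    push_cast
    rw [S_add_two, eval_sub, eval_mul, eval_X, Function.comp_apply]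
    field_simp
    ring

end Chebyshev

section Families

open scoped Matrix

lemma transpose_stepMatrix (R : Type*) [Semiring R] (down : Bool) :
    (stepMatrix R down)ᵀ = stepMatrix R !down := by
  cases down <;> simp [stepMatrix, ← Matrix.ext_iff, Fin.forall_fin_two]

lemma transpose_chainMatrix (k : ℕ) (down : Bool) :
    (chainMatrix k down)ᵀ = chainMatrix k !down := by
  rw [chainMatrix, Matrix.transpose_pow, transpose_stepMatrix, chainMatrix]

lemma transpose_verticalMatrix (k : ℕ) (down : Bool) :
    (verticalMatrix k down)ᵀ = verticalMatrix k !down := by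
  simp only [verticalMatrix, Matrix.transpose_mul, transpose_stepMatrix, transpose_chainMatrix,
    Bool.not_true, Bool.not_false, mul_assoc]

lemma transpose_horizontalMatrix (k : ℕ) (down : Bool) :
    (horizontalMatrix k down)ᵀ = horizontalMatrix k !down := by
  simp only [horizontalMatrix, Matrix.transpose_mul, transpose_stepMatrix, transpose_chainMatrix,
    Bool.not_true, Bool.not_false, mul_assoc]

lemma offset_one_of_lt {n s : ℕ} (h : s < n + 1) : offset n 1 s = s := by
  rw [offset, one_mul, Nat.mod_eq_of_lt h]

lemma offset_succ_self_odd {n j : ℕ} (h : j ≤ n) :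
    offset (n + 1) n (2 * j + 1) = n - j := by
  obtain ⟨i, rfl⟩ := Nat.exists_eq_add_of_le h
  rw [offset, show (j + i) * (2 * j + 1) = i + (j + i + 1 + (j + i)) * j by ring,
    Nat.add_mul_mod_self_left, Nat.mod_eq_of_lt (by lia), Nat.add_sub_cancel_left]

lemma offset_succ_self_even {n j : ℕ} (h : j ≤ n) :
    offset (n + 1) n (2 * j + 2) = 2 * n - j := by
  obtain ⟨i, rfl⟩ := Nat.exists_eq_add_of_le h
  rw [offset, show (j + i) * (2 * j + 2) = (j + 2 * i) + (j + i + 1 + (j + i)) * j by ring,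
    Nat.add_mul_mod_self_left, Nat.mod_eq_of_lt (by lia)]
  lia

lemma fenceMatrix_succ_one (k n : ℕ) :
    fenceMatrix k (n + 1) 1 =
      ((List.range n).map fun i =>
        chainMatrix k (decide (2 * i < n)) * verticalMatrix k (decide (2 * i + 1 < n))).prod *
      chainMatrix k false := by
  rw [fenceMatrix, diagMatrix, Nat.add_sub_cancel, offset_one_of_lt (by lia),
    decide_eq_false (by lia), show n + 1 + 1 - 2 = n by lia]
  congr 1
  refine prod_range_congr fun i hi => ?_
  rw [cellMatrix, diagMatrix, sideMatrix, offset_one_of_lt (by lia), if_pos (by lia)]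
  congr 2 <;> exact decide_eq_decide.2 (by lia)

theorem fenceMatrix_add_three_one (k n : ℕ) :
    fenceMatrix k (n + 3) 1 =
      (chainMatrix k true * verticalMatrix k true) * fenceMatrix k (n + 1) 1 *
        (chainMatrix k true * verticalMatrix k true)ᵀ := by
  have shift (i : ℕ) : chainMatrix k (decide (2 * (i + 1) < n + 2)) *
        verticalMatrix k (decide (2 * (i + 1) + 1 < n + 2)) =
      chainMatrix k (decide (2 * i < n)) * verticalMatrix k (decide (2 * i + 1 < n)) := by
    congr 2 <;> exact decide_eq_decide.2 (by lia)
  rw [fenceMatrix_succ_one, fenceMatrix_succ_one, List.prod_range_succ', List.prod_range_succ,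
    Matrix.transpose_mul, transpose_chainMatrix, transpose_verticalMatrix]
  simp only [shift, mul_assoc]
  rw [decide_eq_true (show 2 * 0 < n + 2 by lia), decide_eq_true (show 2 * 0 + 1 < n + 2 by lia),
    decide_eq_false (show ¬2 * n < n by lia), decide_eq_false (show ¬2 * n + 1 < n by lia),
    Bool.not_true]

/-- The transfer matrix of a diagonal, a vertical and a diagonal crossed segment in the fence of
`(n + 1, n)`, the chain on the vertical one being directed by `down`. -/
def zigzagMatrix (k : ℕ) (down : Bool) : Matrix (Fin 2) (Fin 2) ℝ :=
  chainMatrix k true * verticalMatrix k down * chainMatrix k false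

lemma transpose_zigzagMatrix (k : ℕ) (down : Bool) :
    (zigzagMatrix k down)ᵀ = zigzagMatrix k !down := by
  simp only [zigzagMatrix, Matrix.transpose_mul, transpose_verticalMatrix, transpose_chainMatrix,
    Bool.not_true, Bool.not_false, mul_assoc]

lemma cellMatrix_mul_diagMatrix_succ_self (k : ℕ) {n j : ℕ} (h : j < n) :
    cellMatrix k (n + 1) n (2 * j + 1) * diagMatrix k (n + 1) n (2 * j + 2) =
      zigzagMatrix k (decide (n ≤ 2 * j)) := by
  rw [cellMatrix, diagMatrix, sideMatrix, diagMatrix, offset_succ_self_odd h.le,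
    offset_succ_self_even h.le, decide_eq_true (show 2 * (n - j) < n + 1 + n by lia),
    decide_eq_false (show ¬2 * (2 * n - j) < n + 1 + n by lia), if_pos (by lia), zigzagMatrix]
  congr 3
  exact decide_eq_decide.2 (by lia)

lemma sideMatrix_succ_self_even (k : ℕ) {n j : ℕ} (h : j + 1 < n) :
    sideMatrix k (n + 1) n (2 * j + 2) = horizontalMatrix k (decide (n ≤ 2 * j + 1)) := by
  rw [sideMatrix, offset_succ_self_even (by lia), if_neg (by lia)]
  congr 1
  exact decide_eq_decide.2 (by lia)

lemma fenceMatrix_add_two_add_one (k n : ℕ) :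
    fenceMatrix k (n + 2) (n + 1) =
      ((List.range n).map fun j =>
        zigzagMatrix k (decide (n < 2 * j)) * horizontalMatrix k (decide (n < 2 * j + 1))).prod *
      zigzagMatrix k (decide (n < 2 * n)) := by
  rw [fenceMatrix, show n + 2 + (n + 1) - 2 = 2 * n + 1 by lia,
    show n + 2 + (n + 1) - 1 = 2 * n + 2 by lia, List.prod_range_succ, prod_range_mul, mul_assoc,
    cellMatrix_mul_diagMatrix_succ_self k n.lt_succ_self]
  congr 1
  refine prod_range_congr fun j hj => ?_
  have cell_even : cellMatrix k (n + 2) (n + 1) (2 * j + 2) =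
      diagMatrix k (n + 2) (n + 1) (2 * j + 2) * sideMatrix k (n + 2) (n + 1) (2 * j + 2) := rfl
  rw [List.prod_range_succ, List.prod_range_succ, List.range_zero, List.map_nil, List.prod_nil,
    one_mul, add_zero, cell_even, ← mul_assoc, cellMatrix_mul_diagMatrix_succ_self k (by lia),
    sideMatrix_succ_self_even k (by lia)]
  simp only [Nat.add_one_le_iff]

theorem fenceMatrix_add_four_add_three (k n : ℕ) :
    fenceMatrix k (n + 4) (n + 3) =
      (zigzagMatrix k false * horizontalMatrix k false) * fenceMatrix k (n + 2) (n + 1) *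
        (zigzagMatrix k false * horizontalMatrix k false)ᵀ := by
  have zigzag_shift (j : ℕ) : zigzagMatrix k (decide (n + 2 < 2 * (j + 1))) =
      zigzagMatrix k (decide (n < 2 * j)) := by
    congr 1
    exact decide_eq_decide.2 (by lia)
  have horizontal_shift (j : ℕ) : horizontalMatrix k (decide (n + 2 < 2 * (j + 1) + 1)) =
      horizontalMatrix k (decide (n < 2 * j + 1)) := by
    congr 1
    exact decide_eq_decide.2 (by lia)
  rw [fenceMatrix_add_two_add_one, fenceMatrix_add_two_add_one, List.prod_range_succ',
    List.prod_range_succ, Matrix.transpose_mul, transpose_zigzagMatrix, transpose_horizontalMatrix]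
  simp only [zigzag_shift, horizontal_shift, mul_assoc]
  rw [decide_eq_false (show ¬n + 2 < 2 * 0 by lia),
    decide_eq_false (show ¬n + 2 < 2 * 0 + 1 by lia),
    decide_eq_true (show n < 2 * n + 1 by lia), decide_eq_true (show n < 2 * (n + 1) by lia),
    Bool.not_false]

end Families

section Recursions

open scoped Matrix

section Module

variable {R V : Type*} [CommRing R] [AddCommGroup V] [Module R V] {x : ℕ → V} {t : R} {c : V}

lemma recursion_of_apply_add_two (φ : V →ₗ[R] V) (hx : ∀ n, x (n + 2) = φ (x n)) (hc : φ c = c)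
    (hzero : φ (x 0) = t • x 1 - x 0 + c)
    (hone : φ (x 1) = t • φ (x 0) - x 1 + c) (n : ℕ) :
    x (n + 2) = t • x (n + 1) - x n + c := by
  induction n using Nat.twoStepInduction with
  | zero => rw [hx, hzero]
  | one => rw [hx, hone, hx]
  | more n ih _ => simpa only [map_add, map_sub, map_smul, hc, ← hx] using congrArg φ ih

lemma apply_eq_of_recursion (hx : ∀ n, x (n + 2) = t • x (n + 1) - x n + c) (f : V →ₗ[R] R)
    {r : R} (hr : t * r - r + f c = r) (hzero : f (x 0) = r) (hone : f (x 1) = r) (n : ℕ) :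
    f (x n) = r := by
  induction n using Nat.twoStepInduction with
  | zero => exact hzero
  | one => exact hone
  | more n ih ih' => rw [hx, map_add, map_sub, map_smul, ih, ih', smul_eq_mul, hr]

end Module

/-- The difference of the off-diagonal entries of a `2 × 2` matrix. -/
def skewPart : Matrix (Fin 2) (Fin 2) ℝ →ₗ[ℝ] ℝ :=
  Matrix.entryLinearMap ℝ ℝ 0 1 - Matrix.entryLinearMap ℝ ℝ 1 0

lemma skewPart_of (a b c d : ℝ) : skewPart !![a, b; c, d] = b - c := rfl

lemma fenceMatrix_one_one (k : ℕ) : fenceMatrix k 1 1 = !![1, 0; (k : ℝ), 1] := by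
  rw [fenceMatrix_succ_one, List.range_zero, List.map_nil, List.prod_nil, one_mul,
    chainMatrix_false]

lemma fenceMatrix_two_one (k : ℕ) :
    fenceMatrix k 2 1 =
      !![2 * (k : ℝ) ^ 2 + 3 * k + 2, (k : ℝ) + 1; 2 * (k : ℝ) + 1, 1] := by
  rw [fenceMatrix_succ_one, List.range_one, List.map_singleton, List.prod_singleton,
    decide_eq_true (by lia), decide_eq_false (by lia), verticalMatrix]
  simp only [chainMatrix_true, chainMatrix_false, stepMatrix_true, stepMatrix_false,
    Matrix.mul_fin_two]
  ring_nf

lemma chainMatrix_mul_verticalMatrix (k : ℕ) :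
    chainMatrix k true * verticalMatrix k true =
      !![2 * (k : ℝ) + 2, 2 * (k : ℝ) + 1; 1, 1] := by
  simp only [verticalMatrix, chainMatrix_true, stepMatrix_true, stepMatrix_false,
    Matrix.mul_fin_two]
  ring_nf

lemma zigzagMatrix_mul_horizontalMatrix (k : ℕ) :
    zigzagMatrix k false * horizontalMatrix k false =
      !![3 * (k : ℝ) ^ 2 + 5 * k + 3, 3 * (k : ℝ) ^ 2 + 6 * k + 4; 3 * (k : ℝ) + 2, 3 * k + 3] := by
  simp only [zigzagMatrix, verticalMatrix, horizontalMatrix, chainMatrix_true, chainMatrix_false,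
    stepMatrix_true, stepMatrix_false, Matrix.mul_fin_two]
  ring_nf

lemma fenceMatrix_three_two (k : ℕ) :
    fenceMatrix k 3 2 =
      !![6 * (k : ℝ) ^ 4 + 22 * (k : ℝ) ^ 3 + 36 * (k : ℝ) ^ 2 + 29 * k + 10,
        6 * (k : ℝ) ^ 3 + 16 * (k : ℝ) ^ 2 + 17 * k + 7;
        6 * (k : ℝ) ^ 3 + 16 * (k : ℝ) ^ 2 + 18 * k + 7, 6 * (k : ℝ) ^ 2 + 10 * k + 5] := by
  rw [fenceMatrix_add_two_add_one, List.range_one, List.map_singleton, List.prod_singleton,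
    decide_eq_false (by lia), decide_eq_false (by lia), zigzagMatrix_mul_horizontalMatrix,
    decide_eq_true (by lia)]
  simp only [zigzagMatrix, verticalMatrix, chainMatrix_true, chainMatrix_false,
    stepMatrix_true, stepMatrix_false, Matrix.mul_fin_two]
  ring_nf

lemma transpose_fin_two_of {R : Type*} (a b c d : R) : !![a, b; c, d]ᵀ = !![a, c; b, d] :=
  Matrix.eta_fin_two _

theorem fenceMatrix_add_three_one_eq (k n : ℕ) :
    fenceMatrix k (n + 3) 1 =
      (2 * k + 3 : ℝ) • fenceMatrix k (n + 2) 1 - fenceMatrix k (n + 1) 1 +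
        !![(k : ℝ) * (2 * k + 1), 0; -((k : ℝ) * (2 * k + 1)), -(k : ℝ)] := by
  refine recursion_of_apply_add_two (x := fun n => fenceMatrix k (n + 1) 1)
    (LinearMap.mulLeftRight ℝ (chainMatrix k true * verticalMatrix k true,
      (chainMatrix k true * verticalMatrix k true)ᵀ)) (fenceMatrix_add_three_one k) ?_ ?_ ?_ n <;>
  simp only [zero_add, fenceMatrix_one_one, fenceMatrix_two_one, LinearMap.mulLeftRight_apply,
    chainMatrix_mul_verticalMatrix, transpose_fin_two_of, Matrix.mul_fin_two, Matrix.smul_of,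
    Matrix.smul_cons, smul_eq_mul, Matrix.smul_empty, Matrix.of_sub_of, Matrix.of_add_of,
    Matrix.cons_sub_cons, Matrix.cons_add_cons, Matrix.empty_sub_empty, Matrix.empty_add_empty,
    Nat.reduceAdd] <;>
  ring_nf

theorem fenceMatrix_add_four_add_three_eq (k n : ℕ) :
    fenceMatrix k (n + 4) (n + 3) =
      (3 * k ^ 2 + 8 * k + 6 : ℝ) • fenceMatrix k (n + 3) (n + 2) -
        fenceMatrix k (n + 2) (n + 1) +
        !![-((k : ℝ) * (3 * k ^ 2 + 6 * k + 4)), (k : ℝ) * (3 * k ^ 2 + 5 * k + 2);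
          -((k : ℝ) * (3 * k + 2)), (k : ℝ) * (3 * k + 2)] := by
  refine recursion_of_apply_add_two (x := fun n => fenceMatrix k (n + 2) (n + 1))
    (LinearMap.mulLeftRight ℝ (zigzagMatrix k false * horizontalMatrix k false,
      (zigzagMatrix k false * horizontalMatrix k false)ᵀ)) (fenceMatrix_add_four_add_three k)
      ?_ ?_ ?_ n <;>
  simp only [zero_add, fenceMatrix_two_one, fenceMatrix_three_two, LinearMap.mulLeftRight_apply,
    zigzagMatrix_mul_horizontalMatrix, transpose_fin_two_of, Matrix.mul_fin_two, Matrix.smul_of,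
    Matrix.smul_cons, smul_eq_mul, Matrix.smul_empty, Matrix.of_sub_of, Matrix.of_add_of,
    Matrix.cons_sub_cons, Matrix.cons_add_cons, Matrix.empty_sub_empty, Matrix.empty_add_empty,
    Nat.reduceAdd] <;>
  ring_nf

lemma fenceMatrix_succ_one_sub (k n : ℕ) :
    fenceMatrix k (n + 1) 1 0 1 - fenceMatrix k (n + 1) 1 1 0 = -k := by
  refine apply_eq_of_recursion (x := fun n => fenceMatrix k (n + 1) 1)
    (fenceMatrix_add_three_one_eq k) skewPart ?_ ?_ ?_ n
  · rw [skewPart_of]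
    ring
  · rw [fenceMatrix_one_one, skewPart_of]
    ring
  · rw [fenceMatrix_two_one, skewPart_of]
    ring

lemma fenceMatrix_add_two_add_one_sub (k n : ℕ) :
    fenceMatrix k (n + 2) (n + 1) 0 1 - fenceMatrix k (n + 2) (n + 1) 1 0 = -k := by
  refine apply_eq_of_recursion (x := fun n => fenceMatrix k (n + 2) (n + 1))
    (fenceMatrix_add_four_add_three_eq k) skewPart ?_ ?_ ?_ n
  · rw [skewPart_of]
    ring
  · rw [fenceMatrix_two_one, skewPart_of]
    ring
  · rw [fenceMatrix_three_two, skewPart_of]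
    ring

lemma entrySum_fenceMatrix_add_three_one (k n : ℕ) :
    entrySum ℝ (fenceMatrix k (n + 3) 1) =
      (2 * k + 3) * entrySum ℝ (fenceMatrix k (n + 2) 1) -
        entrySum ℝ (fenceMatrix k (n + 1) 1) - k := by
  rw [fenceMatrix_add_three_one_eq, map_add, map_sub, map_smul, entrySum_of, smul_eq_mul]
  ring

lemma entrySum_fenceMatrix_add_four_add_three (k n : ℕ) :
    entrySum ℝ (fenceMatrix k (n + 4) (n + 3)) =
      (3 * k ^ 2 + 8 * k + 6) * entrySum ℝ (fenceMatrix k (n + 3) (n + 2)) -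
        entrySum ℝ (fenceMatrix k (n + 2) (n + 1)) - k * (k + 2) := by
  rw [fenceMatrix_add_four_add_three_eq, map_add, map_sub, map_smul, entrySum_of, smul_eq_mul]
  ring

end Recursions

section Asymptotics

lemma tendsto_div_pow_of_recursion {x : ℕ → ℝ} {l l' c : ℝ} (hl : 1 < l) (hl' : |l'| < l)
    (hx : ∀ n, x (n + 2) = (l + l') * x (n + 1) - l * l' * x n + c * (1 - l) * (1 - l')) :
    Tendsto (fun n => x n / l ^ n) atTop (𝓝 ((x 1 - c - l' * (x 0 - c)) / (l - l'))) := by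
  have hpos : 0 < l := one_pos.trans hl
  have hsub : l - l' ≠ 0 := (sub_pos.2 ((le_abs_self l').trans_lt hl')).ne'
  set u := (x 1 - c - l' * (x 0 - c)) / (l - l') with hu
  have closed_form (n : ℕ) : x n = u * l ^ n - (u - (x 0 - c)) * l' ^ n + c := by
    induction n using Nat.twoStepInduction with
    | zero => ring
    | one => rw [hu]; field_simp; ring
    | more n ih ih' => rw [hx, ih, ih']; ring
  have ratio_lim : Tendsto (fun n : ℕ => (l' / l) ^ n) atTop (𝓝 0) :=
    tendsto_pow_atTop_nhds_zero_of_abs_lt_one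
      (by rwa [abs_div, abs_of_pos hpos, div_lt_one hpos])
  have inv_lim : Tendsto (fun n : ℕ => l⁻¹ ^ n) atTop (𝓝 0) :=
    tendsto_pow_atTop_nhds_zero_of_lt_one (inv_nonneg.2 hpos.le) (inv_lt_one_of_one_lt₀ hl)
  have limit := ((ratio_lim.const_mul (u - (x 0 - c))).const_sub u).add (inv_lim.const_mul c)
  rw [mul_zero, mul_zero, sub_zero, add_zero] at limit
  refine limit.congr fun n => ?_
  rw [closed_form n, add_div, sub_div, mul_div_cancel_right₀ _ (pow_ne_zero n hpos.ne'), div_pow,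
    mul_div_assoc, inv_pow, div_eq_mul_inv c]

open Polynomial Chebyshev in
lemma tendsto_div_mul_eval_S {x : ℕ → ℝ} {l a r : ℝ} (hl : 1 < l) (ha : 0 < a) (hr : 0 < r)
    (hx : Tendsto (fun n => x n / l ^ n) atTop (𝓝 a)) (b : ℝ) (d e : ℕ) :
    Tendsto (fun n => x (n * (d + 1) + e) / (x n * (S ℝ d).eval (r * x n - b))) atTop
      (𝓝 (l ^ e / (r * a) ^ d)) := by
  have hpos : 0 < l := one_pos.trans hl
  have pow_lim := tendsto_pow_atTop_atTop_of_one_lt hl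
  have x_lim : Tendsto x atTop atTop := (hx.pos_mul_atTop ha pow_lim).congr fun n =>
    div_mul_cancel₀ _ (pow_ne_zero n hpos.ne')
  have trace_lim : Tendsto (fun n => r * x n - b) atTop atTop :=
    tendsto_atTop_add_const_right _ _ (x_lim.const_mul_atTop hr)
  have trace_div_lim : Tendsto (fun n => (r * x n - b) / l ^ n) atTop (𝓝 (r * a)) := by
    have limit := (hx.const_mul r).sub (pow_lim.const_div_atTop b)
    rw [sub_zero] at limit
    exact limit.congr fun n => by ring
  have eval_div_lim : Tendsto (fun n => (S ℝ d).eval (r * x n - b) / (l ^ n) ^ d) atTop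
      (𝓝 ((r * a) ^ d)) := by
    have limit := ((tendsto_eval_S_div_pow d).comp trace_lim).mul (trace_div_lim.pow d)
    rw [one_mul] at limit
    refine limit.congr' ?_
    filter_upwards [trace_lim.eventually_ne_atTop 0] with n hn
    rw [Function.comp_apply, div_pow, div_mul_div_cancel₀ (pow_ne_zero d hn)]
  have index_lim : Tendsto (fun n : ℕ => n * (d + 1) + e) atTop atTop :=
    tendsto_atTop_mono (fun n => (Nat.le_mul_of_pos_right n d.succ_pos).trans le_self_add)
      tendsto_id
  have limit := ((hx.comp index_lim).div (hx.mul eval_div_lim) (by positivity)).mul_const (l ^ e)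
  rw [div_mul_cancel_left₀ ha.ne', inv_mul_eq_div] at limit
  refine limit.congr fun n => ?_
  rw [Pi.div_apply, Function.comp_apply, div_mul_div_comm, ← pow_succ', pow_add l, pow_mul l,
    div_div_div_eq]
  field_simp

end Asymptotics

section Limits

variable {k : ℕ}

lemma tendsto_genMarkov_one_div_pow {α A : ℝ} (hα : α = 4 * (k : ℝ) ^ 2 + 12 * k + 5)
    (hA : A = (2 * (k : ℝ) ^ 2 + 3 * k + 1 + (1 + k) * √α) / (2 * (1 + 2 * k) * √α)) :
    Tendsto (fun n : ℕ => (genMarkov k n 1 : ℝ) / ((3 + 2 * k + √α) / 2) ^ n) atTop (𝓝 A) := by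
  have hα_pos : 0 < α := by rw [hα]; positivity
  have hs : 0 < √α := Real.sqrt_pos.2 hα_pos
  have hsq : √α ^ 2 = 4 * (k : ℝ) ^ 2 + 12 * k + 5 := by rw [Real.sq_sqrt hα_pos.le, hα]
  generalize √α = s at hA hs hsq ⊢
  have : (0 : ℝ) ≤ k := k.cast_nonneg
  have hl : 1 < (3 + 2 * k + s) / 2 := by linarith
  have hl' : |(3 + 2 * k - s) / 2| < (3 + 2 * k + s) / 2 := abs_lt.2 ⟨by linarith, by linarith⟩
  have hgap : (3 + 2 * k + s) / 2 - (3 + 2 * k - s) / 2 = s := by ring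
  have recursion (n : ℕ) : entrySum ℝ (fenceMatrix k (n + 3) 1) =
      ((3 + 2 * k + s) / 2 + (3 + 2 * k - s) / 2) * entrySum ℝ (fenceMatrix k (n + 2) 1) -
        (3 + 2 * k + s) / 2 * ((3 + 2 * k - s) / 2) * entrySum ℝ (fenceMatrix k (n + 1) 1) +
        k / (1 + 2 * k) * (1 - (3 + 2 * k + s) / 2) * (1 - (3 + 2 * k - s) / 2) := by
    rw [entrySum_fenceMatrix_add_three_one]
    field_simp
    linear_combination (-entrySum ℝ (fenceMatrix k (n + 1) 1) * (1 + 2 * k) + k) * hsq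
  have limit := (tendsto_div_pow_of_recursion
    (x := fun n => entrySum ℝ (fenceMatrix k (n + 1) 1)) hl hl' recursion).div_const
      ((3 + 2 * k + s) / 2)
  rw [← tendsto_add_atTop_iff_nat 1]
  convert limit using 2 with n
  · rw [div_div, ← pow_succ, ← genMarkov_eq_entrySum_fenceMatrix n.succ_pos one_pos, Nat.cast_one]
  · rw [hA, hgap, zero_add, fenceMatrix_one_one, fenceMatrix_two_one, entrySum_of, entrySum_of]
    field_simp
    linear_combination (k + 1) * hsq

lemma tendsto_genMarkov_succ_div_pow {β δ B : ℝ} (hβ : β = 3 * (k : ℝ) ^ 2 + 8 * k + 6)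
    (hδ : δ = 3 * (k : ℝ) ^ 4 + 17 * (k : ℝ) ^ 3 + 34 * (k : ℝ) ^ 2 + 28 * k + 8)
    (hB : B = ((k + 1) * (k + 2) * (β ^ 2 - 4) + δ * √(β ^ 2 - 4)) /
      ((β - 2) * (β ^ 2 - 4))) :
    Tendsto (fun n : ℕ => (genMarkov k (n + 1) n : ℝ) / ((β + √(β ^ 2 - 4)) / 2) ^ n) atTop
      (𝓝 B) := by
  have hβ_gt : 2 < β := by rw [hβ]; nlinarith [(k.cast_nonneg : (0 : ℝ) ≤ k)]
  have hdisc : 0 < β ^ 2 - 4 := by nlinarith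
  have hs : 0 < √(β ^ 2 - 4) := Real.sqrt_pos.2 hdisc
  have hsq : √(β ^ 2 - 4) ^ 2 = β ^ 2 - 4 := Real.sq_sqrt hdisc.le
  generalize √(β ^ 2 - 4) = s at hB hs hsq ⊢
  have hβ_sub : β - 2 ≠ 0 := by linarith
  have hl : 1 < (β + s) / 2 := by linarith
  have hl' : |(β - s) / 2| < (β + s) / 2 := abs_lt.2 ⟨by linarith, by linarith⟩
  have hgap : (β + s) / 2 - (β - s) / 2 = s := by ring
  have recursion (n : ℕ) : entrySum ℝ (fenceMatrix k (n + 4) (n + 3)) =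
      ((β + s) / 2 + (β - s) / 2) * entrySum ℝ (fenceMatrix k (n + 3) (n + 2)) -
        (β + s) / 2 * ((β - s) / 2) * entrySum ℝ (fenceMatrix k (n + 2) (n + 1)) +
        k * (k + 2) / (β - 2) * (1 - (β + s) / 2) * (1 - (β - s) / 2) := by
    rw [entrySum_fenceMatrix_add_four_add_three, ← hβ]
    field_simp
    linear_combination
      (-entrySum ℝ (fenceMatrix k (n + 2) (n + 1)) * (β - 2) + k * (k + 2)) * hsq
  have limit := (tendsto_div_pow_of_recursion
    (x := fun n => entrySum ℝ (fenceMatrix k (n + 2) (n + 1))) hl hl' recursion).div_const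
      ((β + s) / 2)
  rw [← tendsto_add_atTop_iff_nat 1]
  convert limit using 2 with n
  · rw [div_div, ← pow_succ, ← genMarkov_eq_entrySum_fenceMatrix (n + 1).succ_pos n.succ_pos,
      ← Nat.cast_succ]
  · rw [hB, hgap, ← hsq, zero_add, fenceMatrix_two_one, fenceMatrix_three_two, entrySum_of,
      entrySum_of]
    field_simp
    subst hβ hδ
    linear_combination (k + 1) * (k + 2) * hsq

theorem tendsto_genMarkov_one_div_genMarkov_mul {α A : ℝ}
    (hα : α = 4 * (k : ℝ) ^ 2 + 12 * k + 5)
    (hA : A = (2 * (k : ℝ) ^ 2 + 3 * k + 1 + (1 + k) * √α) / (2 * (1 + 2 * k) * √α))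
    (a₁ a₂ : ℕ) :
    Tendsto (fun q : ℕ =>
        (genMarkov k (q * (1 + a₁) + a₂) 1 : ℝ) / (genMarkov k (q * (1 + a₁)) (1 + a₁) : ℝ))
      atTop (𝓝 (((3 + 3 * k) * A) ^ (-(a₁ : ℤ)) * ((3 + 2 * k + √α) / 2) ^ a₂)) := by
  have hs : 0 < √α := Real.sqrt_pos.2 (by rw [hα]; positivity)
  have hA_pos : 0 < A := by rw [hA]; positivity
  have hl : 1 < (3 + 2 * k + √α) / 2 := by linarith [(k.cast_nonneg : (0 : ℝ) ≤ k)]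
  have limit := tendsto_div_mul_eval_S hl hA_pos (by positivity : (0 : ℝ) < 3 + 3 * k)
    (tendsto_genMarkov_one_div_pow hα hA) k a₁ a₂
  rw [zpow_neg, zpow_natCast, inv_mul_eq_div]
  refine limit.congr' ?_
  filter_upwards [eventually_gt_atTop 0] with q hq
  obtain ⟨n, rfl⟩ := Nat.exists_eq_add_one.2 hq
  have multiple := genMarkov_mul_mul n.succ_pos one_pos (fenceMatrix_succ_one_sub k n) a₁
  push_cast at multiple ⊢
  rw [← multiple]
  congr 3 <;> ring_nf

theorem tendsto_genMarkov_mul_div_genMarkov_succ {β δ B : ℝ}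
    (hβ : β = 3 * (k : ℝ) ^ 2 + 8 * k + 6)
    (hδ : δ = 3 * (k : ℝ) ^ 4 + 17 * (k : ℝ) ^ 3 + 34 * (k : ℝ) ^ 2 + 28 * k + 8)
    (hB : B = ((k + 1) * (k + 2) * (β ^ 2 - 4) + δ * √(β ^ 2 - 4)) /
      ((β - 2) * (β ^ 2 - 4)))
    (a₁ a₂ : ℕ) :
    Tendsto (fun q : ℕ =>
        (genMarkov k ((q + 1) * (1 + a₁ + a₂)) (q * (1 + a₁ + a₂)) : ℝ) /
          (genMarkov k (q * (1 + a₁ + a₂) + a₁ + 1) (q * (1 + a₁ + a₂) + a₁) : ℝ))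
      atTop (𝓝 (((3 + 3 * k) * B) ^ (a₁ + a₂) * ((β + √(β ^ 2 - 4)) / 2) ^ (-(a₁ : ℤ)))) := by
  have hβ_sub : 0 < β - 2 := by rw [hβ]; nlinarith [(k.cast_nonneg : (0 : ℝ) ≤ k)]
  have hdisc : 0 < β ^ 2 - 4 := by nlinarith
  have hs := Real.sqrt_pos.2 hdisc
  have hδ_pos : 0 < δ := by rw [hδ]; positivity
  have hB_pos : 0 < B := by rw [hB]; positivity
  have hl : 1 < (β + √(β ^ 2 - 4)) / 2 := by linarith
  have limit := (tendsto_div_mul_eval_S hl hB_pos (by positivity : (0 : ℝ) < 3 + 3 * k)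
    (tendsto_genMarkov_succ_div_pow hβ hδ hB) k (a₁ + a₂) a₁).inv₀ (by positivity)
  rw [inv_div] at limit
  rw [zpow_neg, zpow_natCast, ← div_eq_mul_inv]
  refine limit.congr' ?_
  filter_upwards [eventually_gt_atTop 0] with q hq
  obtain ⟨n, rfl⟩ := Nat.exists_eq_add_one.2 hq
  have multiple := genMarkov_mul_mul (n + 1).succ_pos n.succ_pos
    (fenceMatrix_add_two_add_one_sub k n) (a₁ + a₂)
  push_cast at multiple ⊢
  rw [← multiple, inv_div]
  congr 3 <;> ring_nf

end Limits

theorem mainTheorem5_general (k : ℕ) (α β δ A B : ℝ)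
    (hα : α = 4 * (k : ℝ) ^ 2 + 12 * k + 5)
    (hβ : β = 3 * (k : ℝ) ^ 2 + 8 * k + 6)
    (hδ : δ = 3 * (k : ℝ) ^ 4 + 17 * (k : ℝ) ^ 3 + 34 * (k : ℝ) ^ 2 + 28 * k + 8)
    (hA : A = (2 * (k : ℝ) ^ 2 + 3 * k + 1 + (1 + k) * √α) / (2 * (1 + 2 * k) * √α))
    (hB : B = ((k + 1) * (k + 2) * (β ^ 2 - 4) + δ * √(β ^ 2 - 4)) /
      ((β - 2) * (β ^ 2 - 4)))
    (a₁ a₂ : ℕ) :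
    Tendsto (fun q : ℕ =>
        (genMarkov k (q * (1 + a₁) + a₂) 1 : ℝ) /
          (genMarkov k (q * (1 + a₁)) (1 + a₁) : ℝ))
      atTop
      (𝓝 (((3 + 3 * k) * A) ^ (-(a₁ : ℤ)) * ((3 + 2 * k + √α) / 2) ^ a₂)) ∧
    Tendsto (fun q : ℕ =>
        (genMarkov k ((q + 1) * (1 + a₁ + a₂)) (q * (1 + a₁ + a₂)) : ℝ) /
          (genMarkov k (q * (1 + a₁ + a₂) + a₁ + 1) (q * (1 + a₁ + a₂) + a₁) : ℝ))
      atTop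
      (𝓝 (((3 + 3 * k) * B) ^ (a₁ + a₂) * ((β + √(β ^ 2 - 4)) / 2) ^ (-(a₁ : ℤ)))) :=
  ⟨tendsto_genMarkov_one_div_genMarkov_mul hα hA a₁ a₂,
    tendsto_genMarkov_mul_div_genMarkov_succ hβ hδ hB a₁ a₂⟩

theorem mainTheorem5 (k : ℕ) (α β δ A B : ℝ)
    (hα : α = 4 * (k : ℝ) ^ 2 + 12 * k + 5)
    (hβ : β = 3 * (k : ℝ) ^ 2 + 8 * k + 6)
    (hδ : δ = 3 * (k : ℝ) ^ 4 + 17 * (k : ℝ) ^ 3 + 34 * (k : ℝ) ^ 2 + 28 * k + 8)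
    (hA : A = (2 * (k : ℝ) ^ 2 + 3 * k + 1 + (1 + k) * √α) / (2 * (1 + 2 * k) * √α))
    (hB : B = ((k + 1) * (k + 2) * (β ^ 2 - 4) + δ * √(β ^ 2 - 4)) /
      ((β - 2) * (β ^ 2 - 4)))
    (a₁ a₂ : ℕ) (ha₁ : 0 < a₁) (ha₂ : 0 < a₂) (hcop : Nat.Coprime a₁ a₂) :
    Tendsto (fun q : ℕ =>
        (genMarkov k (q * (1 + a₁) + a₂) 1 : ℝ) /
          (genMarkov k (q * (1 + a₁)) (1 + a₁) : ℝ))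
      atTop
      (𝓝 (((3 + 3 * k) * A) ^ (-(a₁ : ℤ)) * ((3 + 2 * k + √α) / 2) ^ a₂)) ∧
    Tendsto (fun q : ℕ =>
        (genMarkov k ((q + 1) * (1 + a₁ + a₂)) (q * (1 + a₁ + a₂)) : ℝ) /
          (genMarkov k (q * (1 + a₁ + a₂) + a₁ + 1) (q * (1 + a₁ + a₂) + a₁) : ℝ))
      atTop
      (𝓝 (((3 + 3 * k) * B) ^ (a₁ + a₂) * ((β + √(β ^ 2 - 4)) / 2) ^ (-(a₁ : ℤ)))) :=
  mainTheorem5_general k α β δ A B hα hβ hδ hA hB a₁ a₂
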